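/- There is a universal constant $c>0$ such that the following holds. Let $d\ge 1$ and $m\ge 1$ be integers, $D=[-1,1]^d$, $s\in\{2,3\}$, $v\in\mathbb{R}$, $\|a\|_1=\sum_{i=1}^d|a(i)|$, and $(z)_+=\max(z,0)$. Suppose that for all $x\in D$ $$f(x)=v\int_{[0,1]\times\{a\in\mathbb{R}^d:\|a\|_1=1\}}\eta(t,a)\,(a\cdot x-t)_+^{s-1}\,dP(t,a),$$ where $P$ is a (Borel) probability measure on $[0,1]\times\{a\in\mathbb{R}^d:\|a\|_1=1\}$ and $\eta$ is a measurable function with values in $\{-1,+1\}$. (i) If $d\ge 2$, there are $b_k\in[-1,1]$, $a_k\in\mathbb{R}^d$ with $\|a_k\|_1=1$, and $0\le t_k\le 1$ $(k=1,\dots,m)$ such that $f_m(x)=\frac{v}{m}\sum_{k=1}^m b_k(a_k\cdot x-t_k)_+^{s-1}$ satisfies $$\sup_{x\in D}|f(x)-f_m(x)|\le c\,|v|\sqrt{d+\log m}\;m^{-1/2-1/d}\quad\text{if } s=2,$$ $$\sup_{x\in D}|f(x)-f_m(x)|\le c\,|v|\sqrt{d}\;m^{-1/2-1/d}\quad\text{if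 } s=3.$$ (ii) If the $b_k$ are restricted to $\{-1,1\}$, then for every $d\ge 1$ there are such $b_k$, $a_k$, $t_k$ with $\|a_k\|_1=1$ and $0\le t_k\le 1$ for which $$\sup_{x\in D}|f(x)-f_m(x)|\le c\,|v|\sqrt{d+\log m}\;m^{-1/2-1/(d+2)}\quad\text{if } s=2,$$ $$\sup_{x\in D}|f(x)-f_m(x)|\le c\,|v|\sqrt{d}\;m^{-1/2-1/(d+2)}\quad\text{if } s=3.$$ -/

import Mathlib

open MeasureTheory

noncomputable section

/-- The cube `[-1,1]^d`. -/
def cube (d : ℕ) : Set (Fin d → ℝ) :=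
  {x | ∀ i, -1 ≤ x i ∧ x i ≤ 1}

/-- The unit sphere `{a : ‖a‖₁ = 1}` of the `ℓ¹` norm on `ℝ^d`. -/
def l1Sphere (d : ℕ) : Set (Fin d → ℝ) :=
  {a | ∑ i, |a i| = 1}

/-- The parameter space `[0,1] × {a : ‖a‖₁ = 1}`, with elements `(t, a)`. -/
def paramSpace (d : ℕ) : Set (ℝ × (Fin d → ℝ)) :=
  Set.Icc (0 : ℝ) 1 ×ˢ l1Sphere d

/-- The ridge function `x ↦ (a · x - t)_+^(s-1)`; only `s = 2` (ReLU) and `s = 3`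
(squared ReLU) are used. -/
def ridge {d : ℕ} (s : ℕ) (t : ℝ) (a x : Fin d → ℝ) : ℝ :=
  (max (∑ i, a i * x i - t) 0) ^ (s - 1)

/-- `f` admits on the cube the representation
`f x = v ∫ η(t,a) (a · x - t)_+^(s-1) dP(t,a)`. -/
def HasRidgeRepresentation {d : ℕ} (s : ℕ) (v : ℝ) (P : Measure (paramSpace d))
    (η : paramSpace d → ℝ) (f : (Fin d → ℝ) → ℝ) : Prop :=
  ∀ x ∈ cube d, f x = v * ∫ p, η p * ridge s p.1.1 p.1.2 x ∂P

/-- The `m`-term combination `x ↦ (v/m) ∑ b_k (a_k · x - t_k)_+^(s-1)`. -/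
def ridgeComb {d m : ℕ} (s : ℕ) (v : ℝ) (b t : Fin m → ℝ) (a : Fin m → Fin d → ℝ)
    (x : Fin d → ℝ) : ℝ :=
  v / m * ∑ k, b k * ridge s (t k) (a k) x

end

/-! The proof is a halving scheme. The integral is first approximated, to within the target error,
by a plain average of `m * 2 ^ j` signed ridge functions with `j` large. Then `j` times the number
of terms is halved: the parameters are arranged in close pairs and one member of each pair is kept.
The error of a halving from `2 n` to `n` terms is a signed sum of differences within pairs, divided
by `2 n`, so everything rests on choosing the signs well.

Two inputs control a halving. `HasClosePairings` bounds the sum of the squared distances within the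
pairs by order `n ^ (1 - 2 / D)`, because signs, thresholds and directions together form a set of
dimension only `d`. `exists_signs_sup_le` finds signs for which the signed sum is small uniformly on
the cube, by Hoeffding's bound and chaining over dyadic grids. For `s = 3` the differences within
pairs are Lipschitz in `x` with a constant proportional to the distance of the pair, so chaining
starts at scale 1. For `s = 2` no such gain is used; chaining starts at scale about `n ^ (-1 / D)`,
and this costs the logarithm.

The resulting error is of order `ridgeRate s d D n`. It decays geometrically when `n` doubles, so
the sum over all halvings is dominated by the last one.

Pairings come from a greedy packing argument when `D ≥ 3`. At `D = 2` that argument would lose a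
logarithm, and a short path through a right isosceles triangle replaces it. Thus `D = d` is possible
for `d ≥ 2`, and `D = 3 = d + 2` serves for `d = 1`. All coefficients produced are `±1`, so the two
parts of the theorem differ only in the choice of `D`. -/

/-! ### Tail bounds for signed sums. -/

/-- The signed sum `∑ ± c i`, with the signs given by `ε`. -/
def signedSum {ι : Type*} [Fintype ι] (ε : ι → Bool) (c : ι → ℝ) : ℝ :=
  ∑ i, if ε i then c i else -c i

theorem signedSum_sub {ι : Type*} [Fintype ι] (ε : ι → Bool) (c e : ι → ℝ) :
    signedSum ε (fun i => c i - e i) = signedSum ε c - signedSum ε e := by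
  unfold signedSum
  rw [← Finset.sum_sub_distrib]
  refine Finset.sum_congr rfl fun i _ => ?_
  split_ifs <;> ring

theorem signedSum_smul {ι : Type*} [Fintype ι] (ε : ι → Bool) (r : ℝ) (c : ι → ℝ) :
    signedSum ε (fun i => r * c i) = r * signedSum ε c := by
  unfold signedSum
  rw [Finset.mul_sum]
  refine Finset.sum_congr rfl fun i _ => ?_
  split_ifs <;> ring

theorem abs_signedSum_le {ι : Type*} [Fintype ι] (ε : ι → Bool) (c : ι → ℝ) :
    |signedSum ε c| ≤ ∑ i, |c i| := by
  unfold signedSum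
  refine (Finset.abs_sum_le_sum_abs _ _).trans (Finset.sum_le_sum fun i _ => ?_)
  split_ifs <;> simp

theorem abs_signedSum_le_sqrt {ι : Type*} [Fintype ι] (ε : ι → Bool) (c : ι → ℝ) {σ : ℝ}
    (hσ : 0 ≤ σ) (hc : ∑ i, c i ^ 2 ≤ σ ^ 2) :
    |signedSum ε c| ≤ Real.sqrt (Fintype.card ι) * σ := by
  refine (abs_signedSum_le ε c).trans ?_
  refine abs_le_of_sq_le_sq' ?_ (by positivity) |>.2
  have h := sq_sum_le_card_mul_sum_sq (s := Finset.univ) (f := fun i => |c i|)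
  simp only [sq_abs, Finset.card_univ] at h
  rw [mul_pow, Real.sq_sqrt (by positivity)]
  exact h.trans (by gcongr)

theorem sum_exp_signedSum_le {ι : Type*} [Fintype ι] [DecidableEq ι] (c : ι → ℝ) :
    ∑ ε : ι → Bool, Real.exp (signedSum ε c) ≤
      2 ^ Fintype.card ι * Real.exp ((∑ i, c i ^ 2) / 2) := by
  have h : ∑ ε : ι → Bool, Real.exp (signedSum ε c) =
      ∏ i, ∑ b : Bool, Real.exp (if b then c i else -c i) := by
    rw [Finset.prod_univ_sum, Fintype.piFinset_univ]
    exact Finset.sum_congr rfl fun ε _ => Real.exp_sum _ _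
  rw [h, Finset.sum_div, Real.exp_sum, ← Finset.card_univ, ← Finset.prod_const,
    ← Finset.prod_mul_distrib]
  refine Finset.prod_le_prod (fun i _ => by positivity) fun i _ => ?_
  have := Real.cosh_le_exp_half_sq (c i)
  rw [Real.cosh_eq] at this
  simp only [Fintype.sum_bool, if_true, Bool.false_eq_true, if_false]
  linarith

/-- Hoeffding's inequality as a count of sign patterns: the exponential moment at parameter `u / σ`
gives `exp (u ^ 2 / 2 - u ^ 2)` for each of the two tails. The case `σ = 0` is separate because of
the division. -/
theorem card_signedSum_large_le {ι : Type*} [Fintype ι] [DecidableEq ι] (c : ι → ℝ) {σ u : ℝ}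
    (hu : 0 ≤ u) (hσ : 0 ≤ σ) (hc : ∑ i, c i ^ 2 ≤ σ ^ 2) :
    ((Finset.univ.filter fun ε : ι → Bool => u * σ < |signedSum ε c|).card : ℝ) ≤
      2 ^ Fintype.card ι * (2 * Real.exp (-(u ^ 2 / 2))) := by
  rcases hσ.eq_or_lt with rfl | hσ
  · rw [Finset.filter_false_of_mem]
    · simp; positivity
    · intro ε _
      have := abs_signedSum_le_sqrt ε c le_rfl hc
      simpa using this
  have hlam : ∑ i, (u / σ * c i) ^ 2 ≤ u ^ 2 := by
    simp only [mul_pow, ← Finset.mul_sum]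
    calc (u / σ) ^ 2 * ∑ i, c i ^ 2 ≤ (u / σ) ^ 2 * σ ^ 2 := by gcongr
      _ = u ^ 2 := by field_simp
  have hneg : ∑ i, (-(u / σ) * c i) ^ 2 ≤ u ^ 2 := by simpa [neg_mul] using hlam
  have key : (Finset.univ.filter fun ε : ι → Bool => u * σ < |signedSum ε c|).card *
      Real.exp (u ^ 2) ≤ 2 * (2 ^ Fintype.card ι * Real.exp (u ^ 2 / 2)) := by
    calc _ = ∑ ε ∈ Finset.univ.filter fun ε : ι → Bool => u * σ < |signedSum ε c|,
          Real.exp (u ^ 2) := by simp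
      _ ≤ ∑ ε ∈ Finset.univ.filter fun ε : ι → Bool => u * σ < |signedSum ε c|,
          (Real.exp (signedSum ε fun i => u / σ * c i) +
            Real.exp (signedSum ε fun i => -(u / σ) * c i)) := by
          refine Finset.sum_le_sum fun ε hε => ?_
          have hε := (Finset.mem_filter.1 hε).2
          rw [signedSum_smul, signedSum_smul]
          have h2 : u ^ 2 ≤ u / σ * |signedSum ε c| := by
            calc u ^ 2 = u / σ * (u * σ) := by field_simp
              _ ≤ _ := by gcongr
          rcases abs_cases (signedSum ε c) with ⟨h, -⟩ | ⟨h, -⟩ <;> rw [h] at h2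
          · have := Real.exp_le_exp.2 h2
            have := Real.exp_pos (-(u / σ) * signedSum ε c)
            linarith
          · have := Real.exp_le_exp.2 h2
            rw [mul_neg, ← neg_mul] at this
            have := Real.exp_pos ((u / σ) * signedSum ε c)
            linarith
      _ ≤ ∑ ε : ι → Bool, (Real.exp (signedSum ε fun i => u / σ * c i) +
            Real.exp (signedSum ε fun i => -(u / σ) * c i)) :=
          Finset.sum_le_sum_of_subset_of_nonneg (Finset.filter_subset _ _)
            fun _ _ _ => by positivity
      _ ≤ 2 ^ Fintype.card ι * Real.exp (u ^ 2 / 2) +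
          2 ^ Fintype.card ι * Real.exp (u ^ 2 / 2) := by
          rw [Finset.sum_add_distrib]
          gcongr
          · exact (sum_exp_signedSum_le _).trans (by gcongr)
          · exact (sum_exp_signedSum_le _).trans (by gcongr)
      _ = _ := by ring
  have he : Real.exp (u ^ 2 / 2) = Real.exp (-(u ^ 2 / 2)) * Real.exp (u ^ 2) := by
    rw [← Real.exp_add]; congr 1; ring
  rw [he] at key
  refine le_of_mul_le_mul_right (key.trans_eq ?_) (Real.exp_pos (u ^ 2))
  ring

theorem exp_neg_two_mul_le (N : ℕ) : Real.exp (-(2 * N : ℝ)) ≤ (1 / 2) ^ N := by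
  rw [show -(2 * N : ℝ) = (N : ℕ) * (-2 : ℝ) by ring, Real.exp_nat_mul]
  have h : Real.exp (-2) ≤ 1 / 2 := by
    rw [Real.exp_neg, ← one_div]
    have := Real.add_one_le_exp (2 : ℝ)
    exact one_div_le_one_div_of_le (by norm_num) (by linarith)
  gcongr

/-- At the threshold `2 √(q + r + 1)` the Hoeffding exponent is `2 (q + r + 1)`, and `exp (-2) ≤ 1 /
2`. Of the resulting powers of `1 / 2`, `q` pay for the union bound, one for the two tails, and `r`
remain. -/
theorem card_exists_signedSum_large_le {ι α : Type*} [Fintype ι] [DecidableEq ι] (s : Finset α)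
    (c : α → ι → ℝ) {σ : ℝ} (q r : ℕ) (hs : s.card ≤ 2 ^ q)
    (hσ : 0 ≤ σ) (hc : ∀ l ∈ s, ∑ i, c l i ^ 2 ≤ σ ^ 2) :
    ((Finset.univ.filter fun ε : ι → Bool =>
      ∃ l ∈ s, 2 * Real.sqrt (q + r + 1) * σ < |signedSum ε (c l)|).card : ℝ) ≤
      2 ^ Fintype.card ι * (1 / 2) ^ r := by
  classical
  set u := 2 * Real.sqrt (q + r + 1) with hu
  have hu2 : u ^ 2 / 2 = 2 * ((q + r + 1 : ℕ) : ℝ) := by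
    rw [hu, mul_pow, Real.sq_sqrt (by positivity)]; push_cast; ring
  have hsub : (Finset.univ.filter fun ε : ι → Bool => ∃ l ∈ s, u * σ < |signedSum ε (c l)|) ⊆
      s.biUnion fun l => Finset.univ.filter fun ε : ι → Bool => u * σ < |signedSum ε (c l)| := by
    intro ε hε
    simpa using hε
  calc _ ≤ ((s.biUnion fun l => Finset.univ.filter fun ε : ι → Bool =>
          u * σ < |signedSum ε (c l)|).card : ℝ) := by
        exact_mod_cast Finset.card_le_card hsub
    _ ≤ ∑ l ∈ s, ((Finset.univ.filter fun ε : ι → Bool =>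
          u * σ < |signedSum ε (c l)|).card : ℝ) := by
        exact_mod_cast Finset.card_biUnion_le
    _ ≤ ∑ l ∈ s, (2 : ℝ) ^ Fintype.card ι * (2 * (1 / 2) ^ (q + r + 1)) := by
        refine Finset.sum_le_sum fun l hl => (card_signedSum_large_le (c l) (by positivity) hσ (hc l hl)).trans ?_
        rw [hu2]
        gcongr
        exact exp_neg_two_mul_le _
    _ = s.card * ((2 : ℝ) ^ Fintype.card ι * (2 * (1 / 2) ^ (q + r + 1))) := by simp
    _ ≤ (2 ^ q : ℕ) * ((2 : ℝ) ^ Fintype.card ι * (2 * (1 / 2) ^ (q + r + 1))) := by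
        gcongr
    _ = 2 ^ Fintype.card ι * (1 / 2) ^ r := by
        push_cast
        rw [pow_add, pow_add]
        have : (2 : ℝ) ^ q * (1 / 2) ^ q = 1 := by rw [← mul_pow]; norm_num
        linear_combination (2 ^ Fintype.card ι * (1 / 2) ^ r : ℝ) * this

theorem sum_add_one_div_two_pow_le (K : ℕ) :
    ∑ i ∈ Finset.range K, ((i : ℝ) + 1) * (1 / 2) ^ i ≤ 4 := by
  have : ∑ i ∈ Finset.range K, ((i : ℝ) + 1) * (1 / 2) ^ i = 4 - (K + 2) * 2 * (1 / 2) ^ K := by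
    induction K with
    | zero => norm_num
    | succ K ih => rw [Finset.sum_range_succ, ih, pow_succ]; push_cast; ring
  rw [this]
  have : (0 : ℝ) ≤ (K + 2) * 2 * (1 / 2) ^ K := by positivity
  linarith

/-- Union bound over levels: level `j` spoils at most a fraction `2 ^ (-(j + 2))` of the sign
patterns, and these fractions add up to less than 1. -/
theorem exists_signs_small_on_levels {ι α : Type*} [Fintype ι] (K : ℕ) (s : ℕ → Finset α)
    (c : ℕ → α → ι → ℝ) (σ : ℕ → ℝ) (q : ℕ → ℕ) (hs : ∀ j, (s j).card ≤ 2 ^ q j)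
    (hσ : ∀ j, 0 ≤ σ j) (hc : ∀ j, ∀ l ∈ s j, ∑ i, c j l i ^ 2 ≤ σ j ^ 2) :
    ∃ ε : ι → Bool, ∀ j < K, ∀ l ∈ s j,
      |signedSum ε (c j l)| ≤ 2 * Real.sqrt (q j + (j + 2 : ℕ) + 1) * σ j := by
  classical
  by_contra! hcon
  have hgeo : ∀ K : ℕ, ∑ j ∈ Finset.range K, ((1 : ℝ) / 2) ^ (j + 2) < 1 := by
    intro K
    have : ∑ j ∈ Finset.range K, ((1 : ℝ) / 2) ^ (j + 2) = 1 / 2 - (1 / 2) ^ (K + 1) := by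
      induction K with
      | zero => norm_num
      | succ K ih => rw [Finset.sum_range_succ, ih]; ring
    rw [this]
    have : (0 : ℝ) < (1 / 2) ^ (K + 1) := by positivity
    linarith
  have hsub : (Finset.univ : Finset (ι → Bool)) ⊆ (Finset.range K).biUnion fun j =>
      Finset.univ.filter fun ε : ι → Bool =>
        ∃ l ∈ s j, 2 * Real.sqrt (q j + (j + 2 : ℕ) + 1) * σ j < |signedSum ε (c j l)| := by
    intro ε _
    obtain ⟨j, hj, l, hl, h⟩ := hcon ε
    simp only [Finset.mem_biUnion, Finset.mem_range, Finset.mem_filter, Finset.mem_univ, true_and]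
    exact ⟨j, hj, l, hl, h⟩
  have h1 : (2 : ℝ) ^ Fintype.card ι ≤ ∑ j ∈ Finset.range K,
      (2 : ℝ) ^ Fintype.card ι * (1 / 2) ^ (j + 2) := by
    calc (2 : ℝ) ^ Fintype.card ι = ((Finset.univ : Finset (ι → Bool)).card : ℝ) := by
          simp
      _ ≤ _ := Nat.cast_le.2 (Finset.card_le_card hsub)
      _ ≤ _ := Nat.cast_le.2 Finset.card_biUnion_le
      _ ≤ _ := by
        rw [Nat.cast_sum]
        exact Finset.sum_le_sum fun j _ =>
          card_exists_signedSum_large_le (s j) (c j) (q j) (j + 2) (hs j) (hσ j) (hc j)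
  rw [← Finset.mul_sum] at h1
  have h2 : (0 : ℝ) < 2 ^ Fintype.card ι := by positivity
  nlinarith [hgeo K]

/-! ### Dyadic grids and chaining on the cube. -/

/-- The grid of mesh `2⁻ᵏ` in the cube. -/
noncomputable def dyadicGrid (d k : ℕ) : Finset (Fin d → ℝ) :=
  Fintype.piFinset fun _ =>
    (Finset.range (2 ^ (k + 1) + 1)).image fun j : ℕ => (-1 + j * (1 / 2) ^ k : ℝ)

theorem card_dyadicGrid_le (d k : ℕ) : (dyadicGrid d k).card ≤ 2 ^ ((k + 2) * d) := by
  unfold dyadicGrid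
  rw [Fintype.card_piFinset_const, pow_mul]
  refine Nat.pow_le_pow_left (Finset.card_image_le.trans ?_) _
  rw [Finset.card_range]
  have : 1 ≤ 2 ^ (k + 1) := Nat.one_le_two_pow
  have h : 2 ^ (k + 2) = 2 * 2 ^ (k + 1) := by ring
  omega

theorem dyadicGrid_subset_cube {d k : ℕ} {x : Fin d → ℝ} (hx : x ∈ dyadicGrid d k) :
    x ∈ cube d := by
  intro i
  obtain ⟨j, hj, hji⟩ := Finset.mem_image.1 (Fintype.mem_piFinset.1 hx i)
  rw [← hji]
  have hj : (j : ℝ) ≤ 2 ^ (k + 1) := by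
    exact_mod_cast Nat.lt_succ_iff.1 (Finset.mem_range.1 hj)
  have h1 : (j : ℝ) * (1 / 2) ^ k ≤ 2 ^ (k + 1) * (1 / 2) ^ k := by gcongr
  have h2 : (2 : ℝ) ^ (k + 1) * (1 / 2) ^ k = 2 := by
    rw [pow_succ, mul_right_comm, ← mul_pow]; norm_num
  have h3 : (0 : ℝ) ≤ j * (1 / 2) ^ k := by positivity
  constructor <;> linarith

theorem exists_dyadicGrid_dist_le {d : ℕ} (k : ℕ) {x : Fin d → ℝ} (hx : x ∈ cube d) :
    ∃ y ∈ dyadicGrid d k, dist x y ≤ (1 / 2) ^ k := by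
  have h2 : (2 : ℝ) ^ k * (1 / 2) ^ k = 1 := by rw [← mul_pow]; norm_num
  refine ⟨fun i => -1 + (⌊(x i + 1) * 2 ^ k⌋₊ : ℕ) * (1 / 2) ^ k, ?_, ?_⟩
  · refine Fintype.mem_piFinset.2 fun i => Finset.mem_image.2 ⟨_, ?_, rfl⟩
    rw [Finset.mem_range, Nat.lt_succ_iff]
    refine Nat.floor_le_of_le ?_
    push_cast
    rw [pow_succ, mul_comm]
    have := (hx i).2
    gcongr
    linarith
  · refine (dist_pi_le_iff (by positivity)).2 fun i => ?_
    have h0 : 0 ≤ (x i + 1) * 2 ^ k := mul_nonneg (by linarith [(hx i).1]) (by positivity)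
    have hl := Nat.floor_le h0
    have hu := (Nat.lt_floor_add_one ((x i + 1) * 2 ^ k)).le
    have hp : (0 : ℝ) < (1 / 2) ^ k := by positivity
    have hx' : x i = -1 + (x i + 1) * 2 ^ k * (1 / 2) ^ k := by rw [mul_assoc, h2]; ring
    rw [Real.dist_eq, abs_le]
    constructor <;> nlinarith

/-- Chaining: a point is reached from its neighbour on the grid of mesh `2 ^ (-k₀)` by links to
finer and finer grids. Increments shrink geometrically while the logarithms of the numbers of links
grow only linearly, so the series converges. The choice of `k₀` balances the Lipschitz bound against
the pointwise bound `A`; the base grid, with about `2 ^ (d (k₀ + 2))` points, causes the factor `√(d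
(k₀ + 1))`. -/
theorem exists_signs_sup_le {d : ℕ} (hd : 1 ≤ d) {ι : Type*} [Fintype ι]
    (G : (Fin d → ℝ) → ι → ℝ) {A L : ℝ} (hA : 0 ≤ A) (hL : 0 ≤ L) (k₀ : ℕ)
    (hG : ∀ x ∈ cube d, ∑ i, G x i ^ 2 ≤ A ^ 2)
    (hLip : ∀ x ∈ cube d, ∀ y ∈ cube d, ∑ i, (G x i - G y i) ^ 2 ≤ (L * dist x y) ^ 2)
    (hLA : L * (1 / 2) ^ k₀ ≤ A) :
    ∃ ε : ι → Bool, ∀ x ∈ cube d,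
      |signedSum ε (G x)| ≤ 55 * A * Real.sqrt (d * (k₀ + 1)) := by
  classical
  set n := Fintype.card ι with hn
  -- Level 0 is the base grid, placed on the diagonal so that all levels share one type; level `j +
  -- 1` consists of the links between consecutive grids.
  let s : ℕ → Finset ((Fin d → ℝ) × (Fin d → ℝ)) := fun j => Nat.casesOn j
    ((dyadicGrid d k₀).image fun x => (x, x))
    fun j => (dyadicGrid d (k₀ + j + 1) ×ˢ dyadicGrid d (k₀ + j)).filter
      fun p => dist p.1 p.2 ≤ 2 * (1 / 2) ^ (k₀ + j)
  let c : ℕ → (Fin d → ℝ) × (Fin d → ℝ) → ι → ℝ := fun j p => Nat.casesOn j (G p.1)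
    fun _ i => G p.1 i - G p.2 i
  let σ : ℕ → ℝ := fun j => Nat.casesOn j A fun j => 2 * A * (1 / 2) ^ j
  let q : ℕ → ℕ := fun j => Nat.casesOn j ((k₀ + 2) * d) fun j => (2 * (k₀ + j) + 5) * d
  have hscale : ∀ j, L * (1 / 2) ^ (k₀ + j) ≤ A * (1 / 2) ^ j := by
    intro j
    rw [pow_add, ← mul_assoc]
    gcongr
  have hs : ∀ j, (s j).card ≤ 2 ^ q j := by
    rintro (_ | j)
    · exact Finset.card_image_le.trans (card_dyadicGrid_le d k₀)
    · refine (Finset.card_filter_le _ _).trans ?_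
      rw [Finset.card_product]
      refine (Nat.mul_le_mul (card_dyadicGrid_le _ _) (card_dyadicGrid_le _ _)).trans_eq ?_
      rw [← pow_add]
      congr 1
      simp only [q]
      ring
  have hσ : ∀ j, 0 ≤ σ j := by
    rintro (_ | j)
    · exact hA
    · simp only [σ]; positivity
  have hc : ∀ j, ∀ l ∈ s j, ∑ i, c j l i ^ 2 ≤ σ j ^ 2 := by
    rintro (_ | j) l hl
    · obtain ⟨x, hx, rfl⟩ := Finset.mem_image.1 hl
      exact hG x (dyadicGrid_subset_cube hx)
    · obtain ⟨hl, hd⟩ := Finset.mem_filter.1 hl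
      obtain ⟨h1, h2⟩ := Finset.mem_product.1 hl
      refine (hLip _ (dyadicGrid_subset_cube h1) _ (dyadicGrid_subset_cube h2)).trans ?_
      simp only [σ]
      refine pow_le_pow_left₀ (by positivity) ?_ 2
      calc L * dist l.1 l.2 ≤ L * (2 * (1 / 2) ^ (k₀ + j)) := by gcongr
        _ ≤ _ := by linarith [hscale j]
  -- One base level and `n` levels of links suffice: at mesh `2 ^ (-(k₀ + n))` Cauchy–Schwarz bounds
  -- the remainder for every choice of signs, since `√n ≤ 2 ^ n`.
  obtain ⟨ε, hε⟩ := exists_signs_small_on_levels (n + 1) s c σ q hs hσ hc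
  refine ⟨ε, fun x hx => ?_⟩
  set M := Real.sqrt (d * (k₀ + 1)) with hM
  have hd1 : (1 : ℝ) ≤ d := by exact_mod_cast hd
  have hk : (0 : ℝ) ≤ k₀ := by positivity
  have hM1 : 1 ≤ M := Real.one_le_sqrt.2 (by nlinarith)
  have hM2 : M ^ 2 = d * (k₀ + 1) := Real.sq_sqrt (by positivity)
  choose y hy hxy using fun k => exists_dyadicGrid_dist_le k hx
  have hbase : |signedSum ε (G (y k₀))| ≤ 6 * A * M := by
    have := hε 0 (by omega) (y k₀, y k₀) (Finset.mem_image.2 ⟨_, hy k₀, rfl⟩)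
    refine this.trans ?_
    change 2 * Real.sqrt ((((k₀ + 2) * d : ℕ) : ℝ) + (0 + 2 : ℕ) + 1) * A ≤ _
    have : Real.sqrt ((((k₀ + 2) * d : ℕ) : ℝ) + (0 + 2 : ℕ) + 1) ≤ 3 * M := by
      refine Real.sqrt_le_iff.2 ⟨by positivity, ?_⟩
      rw [mul_pow, hM2]
      push_cast
      nlinarith
    calc _ ≤ 2 * (3 * M) * A := by gcongr
      _ = _ := by ring
  have hlink : ∀ j < n, |signedSum ε (G (y (k₀ + j + 1))) - signedSum ε (G (y (k₀ + j)))| ≤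
      12 * A * M * ((j + 1) * (1 / 2) ^ j) := by
    intro j hj
    have hmem : (y (k₀ + j + 1), y (k₀ + j)) ∈ s (j + 1) := by
      refine Finset.mem_filter.2 ⟨Finset.mem_product.2 ⟨hy _, hy _⟩, ?_⟩
      have h1 := hxy (k₀ + j + 1)
      have h2 := hxy (k₀ + j)
      have h3 : ((1 : ℝ) / 2) ^ (k₀ + j + 1) ≤ (1 / 2) ^ (k₀ + j) :=
        pow_le_pow_of_le_one (by norm_num) (by norm_num) (by omega)
      have := dist_triangle_left (y (k₀ + j + 1)) (y (k₀ + j)) x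
      simp only
      linarith
    have := hε (j + 1) (by omega) _ hmem
    simp only [c, σ, q] at this
    rw [signedSum_sub] at this
    refine this.trans ?_
    have : Real.sqrt ((((2 * (k₀ + j) + 5) * d : ℕ) : ℝ) + (j + 1 + 2 : ℕ) + 1) ≤
        3 * M * (j + 1) := by
      refine Real.sqrt_le_iff.2 ⟨by positivity, ?_⟩
      rw [mul_pow, mul_pow, hM2]
      push_cast
      have hj0 : (0 : ℝ) ≤ j := by positivity
      have e1 : (2 * ((k₀ : ℝ) + j) + 5) + j + 4 ≤ 9 * (k₀ + 1) * (j + 1) := by nlinarith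
      have e2 : 9 * ((k₀ : ℝ) + 1) * (j + 1) ≤ 9 * (k₀ + 1) * (j + 1) ^ 2 := by
        have : (j : ℝ) + 1 ≤ (j + 1) ^ 2 := by nlinarith
        gcongr
      nlinarith
    calc _ ≤ 2 * (3 * M * (j + 1)) * (2 * A * (1 / 2) ^ j) := by gcongr
      _ = _ := by ring
  have hsum : |signedSum ε (G (y (k₀ + n))) - signedSum ε (G (y k₀))| ≤ 48 * A * M := by
    have h := Finset.sum_range_sub (fun j => signedSum ε (G (y (k₀ + j)))) n
    simp only [add_zero] at h
    rw [← h]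
    calc _ ≤ ∑ j ∈ Finset.range n, 12 * A * M * ((j + 1) * (1 / 2) ^ j : ℝ) :=
          (Finset.abs_sum_le_sum_abs _ _).trans
            (Finset.sum_le_sum fun j hj => hlink j (Finset.mem_range.1 hj))
      _ ≤ 12 * A * M * 4 := by
          rw [← Finset.mul_sum]
          gcongr
          exact sum_add_one_div_two_pow_le n
      _ = _ := by ring
  have hrem : |signedSum ε (G x) - signedSum ε (G (y (k₀ + n)))| ≤ A := by
    rw [← signedSum_sub]
    have h := hLip x hx _ (dyadicGrid_subset_cube (hy (k₀ + n)))
    refine (abs_signedSum_le_sqrt ε _ (by positivity) h).trans ?_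
    have h1 : L * dist x (y (k₀ + n)) ≤ A * (1 / 2) ^ n :=
      (mul_le_mul_of_nonneg_left (hxy _) hL).trans (hscale n)
    have h2 : Real.sqrt n ≤ 2 ^ n := by
      refine Real.sqrt_le_iff.2 ⟨by positivity, ?_⟩
      have h3 : (n : ℝ) ≤ 2 ^ n := by exact_mod_cast Nat.lt_two_pow_self.le
      have h4 : (1 : ℝ) ≤ 2 ^ n := one_le_pow₀ (by norm_num)
      nlinarith
    calc _ ≤ 2 ^ n * (A * (1 / 2) ^ n) := by gcongr
      _ = A * (2 ^ n * (1 / 2) ^ n) := by ring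
      _ = A := by rw [← mul_pow]; norm_num
  have hAM : A ≤ A * M := le_mul_of_one_le_right hA hM1
  -- The constant is `55 = 6 + 48 + 1`: base grid, links and remainder.
  rw [abs_le] at *
  constructor <;> linarith [hbase.1, hbase.2]

/-! ### Lipschitz estimates for ridge functions. -/

/-- A parameter `(b, t, a)` of the signed ridge function `x ↦ b (a · x - t)_+^(s-1)`. -/
abbrev SignedParam (d : ℕ) : Type := ℝ × ℝ × (Fin d → ℝ)

/-- The admissible parameters: `b = ±1`, `0 ≤ t ≤ 1` and `‖a‖₁ = 1`. -/
def SignedParam.Admissible {d : ℕ} (z : SignedParam d) : Prop :=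
  (z.1 = -1 ∨ z.1 = 1) ∧ z.2.1 ∈ Set.Icc (0 : ℝ) 1 ∧ z.2.2 ∈ l1Sphere d

/-- The signed ridge function `x ↦ b (a · x - t)_+^(s-1)`. -/
noncomputable def signedRidge {d : ℕ} (s : ℕ) (z : SignedParam d) (x : Fin d → ℝ) : ℝ :=
  z.1 * ridge s z.2.1 z.2.2 x

/-- The `ℓ¹` distance of two parameters. -/
noncomputable def paramDist {d : ℕ} (z w : SignedParam d) : ℝ :=
  |z.1 - w.1| + |z.2.1 - w.2.1| + ∑ i, |z.2.2 i - w.2.2 i|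

theorem paramDist_nonneg {d : ℕ} (z w : SignedParam d) : 0 ≤ paramDist z w := by
  unfold paramDist; positivity

theorem abs_dot_le {d : ℕ} (a x : Fin d → ℝ) {r : ℝ} (hx : ∀ i, |x i| ≤ r) :
    |∑ i, a i * x i| ≤ (∑ i, |a i|) * r := by
  rw [Finset.sum_mul]
  refine (Finset.abs_sum_le_sum_abs _ _).trans (Finset.sum_le_sum fun i _ => ?_)
  rw [abs_mul]
  exact mul_le_mul_of_nonneg_left (hx i) (abs_nonneg _)

theorem abs_dot_sub_le_dist {d : ℕ} (a x y : Fin d → ℝ) :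
    |∑ i, a i * x i - ∑ i, a i * y i| ≤ (∑ i, |a i|) * dist x y := by
  have := abs_dot_le a (fun i => x i - y i) (r := dist x y) fun i => by
    rw [← Real.dist_eq]; exact dist_le_pi_dist x y i
  simpa only [mul_sub, Finset.sum_sub_distrib] using this

theorem abs_dot_sub_dot_le {d : ℕ} (a b : Fin d → ℝ) {x : Fin d → ℝ} (hx : x ∈ cube d) :
    |∑ i, a i * x i - ∑ i, b i * x i| ≤ ∑ i, |a i - b i| := by
  have := abs_dot_le (fun i => a i - b i) x (r := 1) fun i => abs_le.2 (hx i)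
  simpa only [sub_mul, Finset.sum_sub_distrib, mul_one] using this

theorem dot_sub_le_one {d : ℕ} {t : ℝ} {a x : Fin d → ℝ} (ht : t ∈ Set.Icc (0 : ℝ) 1)
    (ha : a ∈ l1Sphere d) (hx : x ∈ cube d) : ∑ i, a i * x i - t ≤ 1 := by
  have h := abs_dot_le a x (r := 1) fun i => abs_le.2 (hx i)
  rw [show ∑ i, |a i| = 1 from ha] at h
  linarith [(abs_le.1 h).2, ht.1]

theorem abs_max_zero_sub_le (p q : ℝ) : |max p 0 - max q 0| ≤ |p - q| := by
  have := abs_max_sub_max_le_max p 0 q 0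
  simpa using this

theorem abs_max_zero_pow_sub_le {s : ℕ} (hs : s = 2 ∨ s = 3) {p q : ℝ} (hp : p ≤ 1) (hq : q ≤ 1) :
    |max p 0 ^ (s - 1) - max q 0 ^ (s - 1)| ≤ 2 * |p - q| := by
  have h := abs_max_zero_sub_le p q
  have h0 := abs_nonneg (p - q)
  have hp0 : 0 ≤ max p 0 := le_max_right _ _
  have hq0 : 0 ≤ max q 0 := le_max_right _ _
  have hp1 : max p 0 ≤ 1 := max_le hp zero_le_one
  have hq1 : max q 0 ≤ 1 := max_le hq zero_le_one
  rcases hs with rfl | rfl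
  · simp only [Nat.add_one_sub_one, pow_one]; linarith
  · rw [show (3 - 1 : ℕ) = 2 from rfl, sq_sub_sq, abs_mul, abs_of_nonneg (add_nonneg hp0 hq0)]
    gcongr
    linarith

theorem max_zero_pow_mem {s : ℕ} {p : ℝ} (hp : p ≤ 1) :
    max p 0 ^ (s - 1) ∈ Set.Icc (0 : ℝ) 1 :=
  ⟨pow_nonneg (le_max_right _ _) _, pow_le_one₀ (le_max_right _ _) (max_le hp zero_le_one)⟩

theorem hasDerivAt_max_zero_sq (r : ℝ) :
    HasDerivAt (fun r : ℝ => max r 0 ^ 2) (2 * max r 0) r := by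
  rcases lt_trichotomy r 0 with h | rfl | h
  · rw [max_eq_right h.le, mul_zero]
    refine (hasDerivAt_const r (0 : ℝ)).congr_of_eventuallyEq ?_
    filter_upwards [gt_mem_nhds h] with y hy
    rw [max_eq_right hy.le]; norm_num
  · have : HasFDerivAt (fun r : ℝ => max r 0 ^ 2) (0 : ℝ →L[ℝ] ℝ) 0 := by
      refine Asymptotics.IsBigO.hasFDerivAt (n := 2) ?_ one_lt_two
      refine Asymptotics.IsBigO.of_norm_le fun y => ?_
      rw [sub_zero, Real.norm_eq_abs, Real.norm_eq_abs, abs_pow]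
      have := abs_max_zero_sub_le y 0
      simp only [max_self, sub_zero] at this
      gcongr
    simpa using this.hasDerivAt
  · rw [max_eq_left h.le]
    have := (hasDerivAt_pow 2 r)
    simp only [Nat.cast_ofNat, Nat.add_one_sub_one, pow_one] at this
    refine this.congr_of_eventuallyEq ?_
    filter_upwards [lt_mem_nhds h] with y hy
    rw [max_eq_left hy.le]

/-- The mean value inequality along the segments from `p'` to `p` and from `q'` to `q`. As the
derivative `2 (r)_+` is itself Lipschitz, the difference of the two derivatives is small both in `δ`
and in `h`. -/
theorem abs_max_zero_sq_mixed_sub_le {p q p' q' δ h : ℝ} (hq : q ≤ 1) (hq' : q' ≤ 1)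
    (hpq : |p - q| ≤ δ) (hpq' : |p' - q'| ≤ δ) (hp : |p - p'| ≤ h)
    (hmix : |(p - p') - (q - q')| ≤ δ * h) :
    |(max p 0 ^ 2 - max q 0 ^ 2) - (max p' 0 ^ 2 - max q' 0 ^ 2)| ≤ 4 * δ * h := by
  have hd : ∀ θ ∈ Set.Icc (0 : ℝ) 1, HasDerivWithinAt
      (fun θ : ℝ => max (p' + θ * (p - p')) 0 ^ 2 - max (q' + θ * (q - q')) 0 ^ 2)
      (2 * max (p' + θ * (p - p')) 0 * (p - p') - 2 * max (q' + θ * (q - q')) 0 * (q - q'))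
      (Set.Icc 0 1) θ := by
    intro θ _
    have h1 : ∀ u v : ℝ, HasDerivAt (fun θ : ℝ => v + θ * (u - v)) (u - v) θ := fun u v => by
      simpa using ((hasDerivAt_id θ).mul_const (u - v)).const_add v
    exact (((hasDerivAt_max_zero_sq _).comp θ (h1 p p')).sub
      ((hasDerivAt_max_zero_sq _).comp θ (h1 q q'))).hasDerivWithinAt
  have hb : ∀ θ ∈ Set.Icc (0 : ℝ) 1,
      ‖2 * max (p' + θ * (p - p')) 0 * (p - p') - 2 * max (q' + θ * (q - q')) 0 * (q - q')‖ ≤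
        4 * δ * h := by
    rintro θ ⟨h0, h1⟩
    have hδ : |(p' + θ * (p - p')) - (q' + θ * (q - q'))| ≤ δ := by
      rw [abs_le] at *
      constructor <;> nlinarith
    have hm := (abs_max_zero_sub_le _ _).trans hδ
    have hQ0 : 0 ≤ max (q' + θ * (q - q')) 0 := le_max_right _ _
    have hQ1 : max (q' + θ * (q - q')) 0 ≤ 1 := max_le (by nlinarith) zero_le_one
    have hδ0 : 0 ≤ δ := (abs_nonneg _).trans hpq
    have hh0 : 0 ≤ h := (abs_nonneg _).trans hp
    set P := max (p' + θ * (p - p')) 0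
    set Q := max (q' + θ * (q - q')) 0
    rw [Real.norm_eq_abs, show 2 * P * (p - p') - 2 * Q * (q - q') =
      2 * ((P - Q) * (p - p') + Q * ((p - p') - (q - q'))) by ring, abs_mul, abs_two]
    have e1 : |(P - Q) * (p - p')| ≤ δ * h := by
      rw [abs_mul]; gcongr
    have e2 : |Q * ((p - p') - (q - q'))| ≤ 1 * (δ * h) := by
      rw [abs_mul, abs_of_nonneg hQ0]; gcongr
    linarith [abs_add_le ((P - Q) * (p - p')) (Q * ((p - p') - (q - q')))]
  have := (convex_Icc (0 : ℝ) 1).norm_image_sub_le_of_norm_hasDerivWithin_le hd hb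
    (Set.left_mem_Icc.2 zero_le_one) (Set.right_mem_Icc.2 zero_le_one)
  simpa using this

section
variable {d s : ℕ} {z w : SignedParam d} {x y : Fin d → ℝ}

theorem SignedParam.Admissible.abs_fst (hz : z.Admissible) : |z.1| = 1 := by
  rcases hz.1 with h | h <;> rw [h] <;> simp

theorem abs_signedRidge_le_one (hz : z.Admissible) (hx : x ∈ cube d) :
    |signedRidge s z x| ≤ 1 := by
  have h := max_zero_pow_mem (s := s) (dot_sub_le_one hz.2.1 hz.2.2 hx)
  rw [signedRidge, ridge, abs_mul, hz.abs_fst, one_mul, abs_of_nonneg h.1]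
  exact h.2

theorem abs_signedRidge_sub_le_paramDist (hs : s = 2 ∨ s = 3) (hz : z.Admissible)
    (hw : w.Admissible) (hx : x ∈ cube d) :
    |signedRidge s z x - signedRidge s w x| ≤ 2 * paramDist z w := by
  have hz1 := dot_sub_le_one hz.2.1 hz.2.2 hx
  have hw1 := dot_sub_le_one hw.2.1 hw.2.2 hx
  have h := abs_max_zero_pow_sub_le hs hz1 hw1
  have hW := max_zero_pow_mem (s := s) hw1
  have hd := abs_dot_sub_dot_le z.2.2 w.2.2 hx
  unfold signedRidge ridge paramDist
  set p := ∑ i, z.2.2 i * x i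
  set q := ∑ i, w.2.2 i * x i
  have hpq : |(p - z.2.1) - (q - w.2.1)| ≤ |z.2.1 - w.2.1| + |p - q| := by
    rw [show (p - z.2.1) - (q - w.2.1) = -(z.2.1 - w.2.1) + (p - q) by ring]
    exact (abs_add_le _ _).trans_eq (by rw [abs_neg])
  rw [show z.1 * max (p - z.2.1) 0 ^ (s - 1) - w.1 * max (q - w.2.1) 0 ^ (s - 1) =
    z.1 * (max (p - z.2.1) 0 ^ (s - 1) - max (q - w.2.1) 0 ^ (s - 1)) +
      (z.1 - w.1) * max (q - w.2.1) 0 ^ (s - 1) by ring]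
  refine (abs_add_le _ _).trans ?_
  rw [abs_mul, abs_mul, hz.abs_fst, one_mul, abs_of_nonneg hW.1]
  have := mul_le_of_le_one_right (abs_nonneg (z.1 - w.1)) hW.2
  have := abs_nonneg (z.1 - w.1)
  linarith

theorem abs_ridge_sub_le_dist (hs : s = 2 ∨ s = 3) (hz : z.Admissible)
    (hx : x ∈ cube d) (hy : y ∈ cube d) :
    |ridge s z.2.1 z.2.2 x - ridge s z.2.1 z.2.2 y| ≤ 2 * dist x y := by
  have h := abs_max_zero_pow_sub_le hs (dot_sub_le_one hz.2.1 hz.2.2 hx)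
    (dot_sub_le_one hz.2.1 hz.2.2 hy)
  have hd := abs_dot_sub_le_dist z.2.2 x y
  rw [show ∑ i, |z.2.2 i| = 1 from hz.2.2, one_mul] at hd
  rw [sub_sub_sub_cancel_right] at h
  unfold ridge
  linarith

theorem abs_signedRidge_sub_le_dist (hs : s = 2 ∨ s = 3) (hz : z.Admissible)
    (hx : x ∈ cube d) (hy : y ∈ cube d) :
    |signedRidge s z x - signedRidge s z y| ≤ 2 * dist x y := by
  unfold signedRidge
  rw [← mul_sub, abs_mul, hz.abs_fst, one_mul]
  exact abs_ridge_sub_le_dist hs hz hx hy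

/-- The gain specific to `s = 3`: the difference of two nearby ridge functions has a small Lipschitz
constant in `x`, which removes the logarithm from the rate. -/
theorem abs_signedRidge_three_mixed_sub_le (hz : z.Admissible) (hw : w.Admissible)
    (hx : x ∈ cube d) (hy : y ∈ cube d) :
    |(signedRidge 3 z x - signedRidge 3 w x) - (signedRidge 3 z y - signedRidge 3 w y)| ≤
      4 * paramDist z w * dist x y := by
  have hyw := abs_ridge_sub_le_dist (Or.inr rfl) hw hx hy
  have hwx := dot_sub_le_one hw.2.1 hw.2.2 hx
  have hwy := dot_sub_le_one hw.2.1 hw.2.2 hy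
  have hdx := abs_dot_sub_dot_le z.2.2 w.2.2 hx
  have hdy := abs_dot_sub_dot_le z.2.2 w.2.2 hy
  have hd := abs_dot_sub_le_dist z.2.2 x y
  rw [show ∑ i, |z.2.2 i| = 1 from hz.2.2, one_mul] at hd
  have hm := abs_dot_sub_le_dist (fun i => z.2.2 i - w.2.2 i) x y
  simp only [sub_mul, Finset.sum_sub_distrib] at hm
  set δ := |z.2.1 - w.2.1| + ∑ i, |z.2.2 i - w.2.2 i| with hδ
  have htri : ∀ p q : ℝ, |p - q| ≤ ∑ i, |z.2.2 i - w.2.2 i| →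
      |(p - z.2.1) - (q - w.2.1)| ≤ δ := by
    intro p q h
    rw [show (p - z.2.1) - (q - w.2.1) = -(z.2.1 - w.2.1) + (p - q) by ring]
    refine (abs_add_le _ _).trans ?_
    rw [abs_neg]; linarith
  have key := abs_max_zero_sq_mixed_sub_le (h := dist x y) hwx hwy (htri _ _ hdx) (htri _ _ hdy)
    (by rwa [sub_sub_sub_cancel_right]) (by
      rw [sub_sub_sub_cancel_right, sub_sub_sub_cancel_right, sub_sub_sub_comm]
      refine hm.trans (mul_le_mul_of_nonneg_right ?_ dist_nonneg)
      linarith [abs_nonneg (z.2.1 - w.2.1)])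
  have hsplit : (signedRidge 3 z x - signedRidge 3 w x) - (signedRidge 3 z y - signedRidge 3 w y) =
      z.1 * ((ridge 3 z.2.1 z.2.2 x - ridge 3 w.2.1 w.2.2 x) -
        (ridge 3 z.2.1 z.2.2 y - ridge 3 w.2.1 w.2.2 y)) +
      (z.1 - w.1) * (ridge 3 w.2.1 w.2.2 x - ridge 3 w.2.1 w.2.2 y) := by
    unfold signedRidge; ring
  rw [hsplit]
  refine (abs_add_le _ _).trans ?_
  rw [abs_mul, abs_mul, hz.abs_fst, one_mul]
  have h2 : |z.1 - w.1| * |ridge 3 w.2.1 w.2.2 x - ridge 3 w.2.1 w.2.2 y| ≤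
      |z.1 - w.1| * (2 * dist x y) := by gcongr
  have h3 : 0 ≤ |z.1 - w.1| * dist x y := by positivity
  have h4 : paramDist z w = |z.1 - w.1| + δ := by rw [hδ, paramDist]; ring
  rw [h4]
  have key' : |(ridge 3 z.2.1 z.2.2 x - ridge 3 w.2.1 w.2.2 x) -
        (ridge 3 z.2.1 z.2.2 y - ridge 3 w.2.1 w.2.2 y)| ≤ 4 * δ * dist x y := key
  linarith

end

/-! ### Greedy pairings. -/

/-- The list of pairs `W` is a way to arrange the entries of `l` in pairs. -/
def IsPairing {α : Type*} (l : List α) (W : List (α × α)) : Prop :=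
  (W.map Prod.fst ++ W.map Prod.snd).Perm l

theorem IsPairing.cons {α : Type*} {l l' : List α} {W : List (α × α)} {a b : α}
    (hW : IsPairing l' W) (h : l.Perm (a :: b :: l')) : IsPairing l ((a, b) :: W) := by
  unfold IsPairing at *
  refine List.Perm.trans ?_ h.symm
  simp only [List.map_cons, List.cons_append]
  refine List.Perm.cons a (List.perm_middle.trans (List.Perm.cons b hW))

theorem IsPairing.mem {α : Type*} {l : List α} {W : List (α × α)} (hW : IsPairing l W)
    {p : α × α} (hp : p ∈ W) : p.1 ∈ l ∧ p.2 ∈ l :=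
  ⟨hW.mem_iff.1 (List.mem_append_left _ (List.mem_map_of_mem hp)),
    hW.mem_iff.1 (List.mem_append_right _ (List.mem_map_of_mem hp))⟩

theorem IsPairing.length {α : Type*} {l : List α} {W : List (α × α)} (hW : IsPairing l W) :
    2 * W.length = l.length := by
  have := List.Perm.length_eq hW
  simp only [List.length_append, List.length_map] at this
  omega

theorem IsPairing.sum {α : Type*} {l : List α} {W : List (α × α)} (hW : IsPairing l W)
    (F : α → ℝ) : (l.map F).sum = (W.map fun p => F p.1 + F p.2).sum := by
  rw [← (List.Perm.map F hW).sum_eq, List.map_append, List.sum_append, List.map_map, List.map_map,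
    ← List.sum_map_add]
  rfl

/-- Greedy choice: remove a closest available pair and repeat; with `2 k` entries left the cost is
at most `e k`. -/
theorem exists_isPairing_of_close_pair {α : Type*} (P : α → Prop) (δ : α → α → ℝ) (e : ℕ → ℝ)
    (h : ∀ n : ℕ, 1 ≤ n → ∀ l : List α, (∀ z ∈ l, P z) → l.length = 2 * n →
      ∃ a b l', l.Perm (a :: b :: l') ∧ δ a b ≤ e n) (n : ℕ) :
    ∀ l : List α, (∀ z ∈ l, P z) → l.length = 2 * n →
      ∃ W, IsPairing l W ∧ (W.map fun p => δ p.1 p.2).sum ≤ ∑ k ∈ Finset.range n, e (k + 1) := by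
  induction n with
  | zero =>
    intro l _ hl
    obtain rfl := List.length_eq_zero_iff.1 hl
    exact ⟨[], List.Perm.nil, by simp⟩
  | succ n ih =>
    intro l hP hl
    obtain ⟨a, b, l', hl', hab⟩ := h (n + 1) (by omega) l hP hl
    have hlen := hl'.length_eq
    simp only [List.length_cons] at hlen
    obtain ⟨W, hW, hs⟩ := ih l' (fun z hz => hP z (hl'.mem_iff.2 (by simp [hz]))) (by omega)
    refine ⟨(a, b) :: W, hW.cons hl', ?_⟩
    rw [List.map_cons, List.sum_cons, Finset.sum_range_succ]
    linarith

/-- The discrete form of integrating `x ^ (β - 1)`; the increment of `n ^ β / β` is bounded below by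
Bernoulli's inequality for exponents at most 1. -/
theorem sum_rpow_sub_one_le {β : ℝ} (h0 : 0 < β) (h1 : β ≤ 1) (n : ℕ) :
    ∑ k ∈ Finset.range n, ((k + 1 : ℕ) : ℝ) ^ (β - 1) ≤ (n : ℝ) ^ β / β := by
  induction n with
  | zero => simp [Real.zero_rpow h0.ne']
  | succ n ih =>
    rw [Finset.sum_range_succ]
    have hpos : (0 : ℝ) < (n + 1 : ℕ) := by positivity
    have hb := rpow_one_add_le_one_add_mul_self (s := -1 / ((n + 1 : ℕ) : ℝ))
      (by rw [le_div_iff₀ hpos]; push_cast; linarith [n.cast_nonneg (α := ℝ)]) h0.le h1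
    have he : 1 + -1 / ((n + 1 : ℕ) : ℝ) = n / (n + 1 : ℕ) := by
      field_simp; push_cast; ring
    rw [he, Real.div_rpow (by positivity) hpos.le, div_le_iff₀ (by positivity)] at hb
    have hsub : ((n + 1 : ℕ) : ℝ) ^ (β - 1) = ((n + 1 : ℕ) : ℝ) ^ β / (n + 1 : ℕ) := by
      rw [Real.rpow_sub_one hpos.ne']
    rw [hsub]
    set X := ((n + 1 : ℕ) : ℝ) ^ β
    have : (n : ℝ) ^ β / β + X / (n + 1 : ℕ) ≤ X / β := by
      have h2 : (1 + β * (-1 / ((n + 1 : ℕ) : ℝ))) * X = β * (X / β - X / (n + 1 : ℕ)) := by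
        field_simp; ring
      rw [h2] at hb
      have h3 : (n : ℝ) ^ β / β ≤ X / β - X / (n + 1 : ℕ) := by
        rw [div_le_iff₀' h0]; exact hb
      linarith
    linarith

theorem exists_perm_of_not_pairwise {α : Type*} {R : α → α → Prop} {l : List α}
    (h : ¬ l.Pairwise R) : ∃ a b l', l.Perm (a :: b :: l') ∧ ¬ R a b := by
  induction l with
  | nil => simp at h
  | cons c l ih =>
    rw [List.pairwise_cons, not_and_or] at h
    rcases h with h | h
    · push Not at h
      obtain ⟨b, hb, hR⟩ := h
      obtain ⟨l₁, l₂, rfl⟩ := List.append_of_mem hb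
      exact ⟨c, b, l₁ ++ l₂, List.Perm.cons c List.perm_middle, hR⟩
    · obtain ⟨a, b, l', hl', hR⟩ := ih h
      refine ⟨a, b, c :: l', (List.Perm.cons c hl').trans ?_, hR⟩
      exact (List.Perm.swap a c _).trans (List.Perm.cons a (List.Perm.swap b c _))

/-! ### Packing of parameters in dimension `d`. -/

-- Volume comparison: the balls of radius `ε / 2` about the points are disjoint and lie in the ball
-- of radius `R + ε / 2`.
open Metric Module in
theorem card_mul_pow_le_of_separated {E : Type*} [NormedAddCommGroup E] [NormedSpace ℝ E]
    [FiniteDimensional ℝ E] (s : Finset E) {R ε : ℝ} (hR : 0 ≤ R) (hε : 0 < ε)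
    (hs : ∀ c ∈ s, ‖c‖ ≤ R) (h : ∀ c ∈ s, ∀ d ∈ s, c ≠ d → ε ≤ ‖c - d‖) :
    s.card * (ε / 2) ^ finrank ℝ E ≤ (R + ε / 2) ^ finrank ℝ E := by
  borelize E
  let μ : Measure E := Measure.addHaar
  have hδ : 0 < ε / 2 := half_pos hε
  have hρ : 0 < R + ε / 2 := by positivity
  set A := ⋃ c ∈ s, ball (c : E) (ε / 2) with hA
  have D : Set.Pairwise (s : Set E) (Function.onFun Disjoint fun c => ball (c : E) (ε / 2)) := by
    rintro c hc d hd hcd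
    apply ball_disjoint_ball
    rw [dist_eq_norm, add_halves]
    exact h c hc d hd hcd
  have A_subset : A ⊆ ball (0 : E) (R + ε / 2) := by
    refine Set.iUnion₂_subset fun x hx => ball_subset_ball' ?_
    rw [dist_zero_right]
    linarith [hs x hx]
  have I : (s.card : ENNReal) * ENNReal.ofReal ((ε / 2) ^ finrank ℝ E) * μ (ball 0 1) ≤
      ENNReal.ofReal ((R + ε / 2) ^ finrank ℝ E) * μ (ball 0 1) :=
    calc _ = μ A := by
          rw [hA, measure_biUnion_finset D fun c _ => measurableSet_ball]
          simp only [μ.addHaar_ball_of_pos _ hδ]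
          simp only [Finset.sum_const, nsmul_eq_mul, mul_assoc]
      _ ≤ μ (ball (0 : E) (R + ε / 2)) := measure_mono A_subset
      _ = _ := by simp only [μ.addHaar_ball_of_pos _ hρ]
  have J : (s.card : ENNReal) * ENNReal.ofReal ((ε / 2) ^ finrank ℝ E) ≤
      ENNReal.ofReal ((R + ε / 2) ^ finrank ℝ E) :=
    (ENNReal.mul_le_mul_iff_left (measure_ball_pos _ _ zero_lt_one).ne' measure_ball_lt_top.ne).1 I
  have K := ENNReal.toReal_le_of_le_ofReal (pow_nonneg hρ.le _) J
  rwa [ENNReal.toReal_mul, ENNReal.toReal_natCast, ENNReal.toReal_ofReal (by positivity)] at K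

/-- The map `(b, t, a) ↦ (2 + t - b) a` of the parameters to the space of dimension `d`. -/
noncomputable def flatParam {d : ℕ} (z : SignedParam d) : PiLp 1 fun _ : Fin d => ℝ :=
  WithLp.toLp 1 fun i => (2 + z.2.1 - z.1) * z.2.2 i

theorem norm_l1_eq {d : ℕ} (v : PiLp 1 fun _ : Fin d => ℝ) : ‖v‖ = ∑ i, |v i| := by
  simp [PiLp.norm_eq_of_L1]

theorem norm_flatParam {d : ℕ} {z : SignedParam d} (hz : z.Admissible) :
    ‖flatParam z‖ = 2 + z.2.1 - z.1 := by
  have h : 0 ≤ 2 + z.2.1 - z.1 := by rcases hz.1 with h | h <;> linarith [hz.2.1.1]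
  rw [norm_l1_eq]
  simp only [flatParam, abs_mul, ← Finset.mul_sum]
  rw [show ∑ i, |z.2.2 i| = 1 from hz.2.2, mul_one, abs_of_nonneg h]

theorem norm_flatParam_le {d : ℕ} {z : SignedParam d} (hz : z.Admissible) :
    ‖flatParam z‖ ≤ 4 := by
  rw [norm_flatParam hz]
  rcases hz.1 with h | h <;> linarith [hz.2.1.2]

/-- In the `ℓ¹` norm the radius of `flatParam z` is `2 + t - b`, which lies in `[1, 2]` for `b = 1`
and in `[3, 4]` for `b = -1`. The radius thus determines `b` and `t`, and the direction is `a`.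
Staying away from the origin keeps the inverse Lipschitz; `7 = 5 + 2` collects the radial part and
the directional part. -/
theorem paramDist_le_norm_flatParam_sub {d : ℕ} {z w : SignedParam d} (hz : z.Admissible)
    (hw : w.Admissible) : paramDist z w ≤ 7 * ‖flatParam z - flatParam w‖ := by
  have h := abs_norm_sub_norm_le (flatParam z) (flatParam w)
  rw [norm_flatParam hz, norm_flatParam hw] at h
  have hr : 1 ≤ 2 + z.2.1 - z.1 := by rcases hz.1 with h | h <;> linarith [hz.2.1.1]
  set N := ‖flatParam z - flatParam w‖ with hN
  have hsum : ∑ i, |z.2.2 i - w.2.2 i| ≤ N + |(2 + z.2.1 - z.1) - (2 + w.2.1 - w.1)| := by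
    have h1 : ∀ i, |z.2.2 i - w.2.2 i| ≤ |(flatParam z - flatParam w) i| +
        |(2 + z.2.1 - z.1) - (2 + w.2.1 - w.1)| * |w.2.2 i| := by
      intro i
      have h2 : (2 + z.2.1 - z.1) * (z.2.2 i - w.2.2 i) = (flatParam z - flatParam w) i +
          -(((2 + z.2.1 - z.1) - (2 + w.2.1 - w.1)) * w.2.2 i) := by
        simp only [flatParam, PiLp.sub_apply]; ring
      calc |z.2.2 i - w.2.2 i| ≤ (2 + z.2.1 - z.1) * |z.2.2 i - w.2.2 i| :=
            le_mul_of_one_le_left (abs_nonneg _) hr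
        _ = |(2 + z.2.1 - z.1) * (z.2.2 i - w.2.2 i)| := by
            rw [abs_mul, abs_of_nonneg (a := 2 + z.2.1 - z.1) (by linarith)]
        _ ≤ _ := by
            rw [h2, ← abs_mul, ← abs_neg (((2 + z.2.1 - z.1) - (2 + w.2.1 - w.1)) * w.2.2 i)]
            exact abs_add_le _ _
    refine (Finset.sum_le_sum fun i _ => h1 i).trans_eq ?_
    rw [Finset.sum_add_distrib, ← Finset.mul_sum, show ∑ i, |w.2.2 i| = 1 from hw.2.2, mul_one,
      hN, norm_l1_eq]
  have hbt : |z.1 - w.1| + |z.2.1 - w.2.1| ≤ 5 * |(2 + z.2.1 - z.1) - (2 + w.2.1 - w.1)| := by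
    obtain ⟨hb, ⟨ht0, ht1⟩, -⟩ := hz
    obtain ⟨hb', ⟨ht0', ht1'⟩, -⟩ := hw
    rcases hb with hb | hb <;> rcases hb' with hb' | hb' <;> rw [hb, hb']
    · rw [show 2 + z.2.1 - -1 - (2 + w.2.1 - -1) = z.2.1 - w.2.1 by ring, sub_self, abs_zero]
      linarith [abs_nonneg (z.2.1 - w.2.1)]
    · have h1 : |z.2.1 - w.2.1| ≤ 1 := abs_le.2 ⟨by linarith, by linarith⟩
      have h2 := le_abs_self ((2 + z.2.1 - -1) - (2 + w.2.1 - 1))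
      norm_num at *
      linarith
    · have h1 : |z.2.1 - w.2.1| ≤ 1 := abs_le.2 ⟨by linarith, by linarith⟩
      have h2 := neg_le_abs ((2 + z.2.1 - 1) - (2 + w.2.1 - -1))
      norm_num at *
      linarith
    · rw [show 2 + z.2.1 - 1 - (2 + w.2.1 - 1) = z.2.1 - w.2.1 by ring, sub_self, abs_zero]
      linarith [abs_nonneg (z.2.1 - w.2.1)]
  unfold paramDist
  linarith

theorem exists_close_pair {d : ℕ} (hd : 1 ≤ d) {n : ℕ} (hn : 1 ≤ n) (l : List (SignedParam d))
    (hl : ∀ z ∈ l, z.Admissible) (hlen : l.length = 2 * n) :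
    ∃ a b l', l.Perm (a :: b :: l') ∧
      ‖flatParam a - flatParam b‖ ≤ 16 * (n : ℝ) ^ (-(1 / (d : ℝ))) := by
  classical
  set ε := 16 * (n : ℝ) ^ (-(1 / (d : ℝ))) with hε
  have hn0 : (0 : ℝ) < n := by exact_mod_cast hn
  have hε0 : 0 < ε := by positivity
  have hnot : ¬ l.Pairwise fun a b => ε ≤ ‖flatParam a - flatParam b‖ := by
    intro hpw
    have hpw' : (l.map flatParam).Pairwise fun a b => ε ≤ ‖a - b‖ := List.pairwise_map.2 hpw
    -- Two points of the ball of radius 4 are at distance at most 8. Hence `4 + ε / 2 ≤ 8`, and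
    -- packing `2 n` points would give `2 * 8 ^ d ≤ 8 ^ d`.
    have hε8 : ε ≤ 8 := by
      match l, hl, hlen, hpw with
      | [], _, hlen, _ => simp at hlen; omega
      | [_], _, hlen, _ => simp at hlen; omega
      | a :: b :: l, hl, _, hpw =>
        have h1 := (List.pairwise_cons.1 hpw).1 b (by simp)
        have h2 := norm_flatParam_le (hl a (by simp))
        have h3 := norm_flatParam_le (hl b (by simp))
        linarith [norm_sub_le (flatParam a) (flatParam b)]
    have hnd : (l.map flatParam).Nodup := hpw'.imp fun {a b} h hab => by
      rw [hab, sub_self, norm_zero] at h; linarith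
    have hcard := card_mul_pow_le_of_separated (l.map flatParam).toFinset (R := 4) (by norm_num) hε0
      (fun c hc => by
        obtain ⟨z, hz, rfl⟩ := List.mem_map.1 (List.mem_toFinset.1 hc)
        exact norm_flatParam_le (hl z hz))
      (fun c hc e he hce => by
        refine (List.Pairwise.forall_of_forall_of_flip (R := fun a b => a ≠ b → ε ≤ ‖a - b‖)
          ?_ ?_ ?_ (List.mem_toFinset.1 hc) (List.mem_toFinset.1 he)) hce
        · intro x _ h; exact absurd rfl h
        · exact hpw'.imp fun {a b} h (_ : a ≠ b) => h
        · exact hpw'.imp fun {a b} h =>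
            show b ≠ a → ε ≤ ‖b - a‖ from fun _ => by rw [norm_sub_rev]; exact h)
    rw [List.toFinset_card_of_nodup hnd, List.length_map, hlen] at hcard
    have hfr : Module.finrank ℝ (PiLp 1 fun _ : Fin d => ℝ) = d :=
      (WithLp.linearEquiv 1 ℝ (Fin d → ℝ)).finrank_eq.trans (by simp)
    rw [hfr] at hcard
    have hpow : (ε / 2) ^ d = 8 ^ d / n := by
      rw [hε, show 16 * (n : ℝ) ^ (-(1 / (d : ℝ))) / 2 = 8 * (n : ℝ) ^ (-(1 / (d : ℝ))) by ring,
        mul_pow, ← Real.rpow_natCast ((n : ℝ) ^ (-(1 / (d : ℝ)))), ← Real.rpow_mul hn0.le]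
      have : (d : ℝ) ≠ 0 := by positivity
      rw [show -(1 / (d : ℝ)) * d = -1 by field_simp, Real.rpow_neg_one]
      rfl
    have h8 : (4 + ε / 2) ^ d ≤ 8 ^ d := by gcongr; linarith
    rw [hpow] at hcard
    push_cast at hcard
    have : 2 * (n : ℝ) * (8 ^ d / n) = 2 * 8 ^ d := by field_simp
    have h9 : (0 : ℝ) < 8 ^ d := by positivity
    linarith
  obtain ⟨a, b, l', hl', h⟩ := exists_perm_of_not_pairwise hnot
  exact ⟨a, b, l', hl', (not_le.1 h).le⟩

/-- Summing the greedy costs `k ^ (-2 / D)` gives `n ^ β / β` with `β = 1 - 2 / D`. The condition `D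
≥ 3` keeps `1 / β ≤ 3`, so the constant is uniform in the dimension. Here `112 = 7 * 16` and `3 *
112 ^ 2 ≤ 224 ^ 2`. -/
theorem exists_isPairing_of_three_le {d : ℕ} (hd : 1 ≤ d) {D : ℝ} (hD : 3 ≤ D) (hdD : d ≤ D)
    {n : ℕ} (hn : 1 ≤ n) (l : List (SignedParam d))
    (hl : ∀ z ∈ l, z.Admissible) (hlen : l.length = 2 * n) :
    ∃ W, IsPairing l W ∧ (W.map fun p => paramDist p.1 p.2 ^ 2).sum ≤
      (224 * (n : ℝ) ^ (1 / 2 - 1 / D)) ^ 2 := by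
  have hD0 : 0 < D := by linarith
  have hinv : 1 / D ≤ 1 / 3 := one_div_le_one_div_of_le (by norm_num) hD
  have hinv0 : 0 < 1 / D := by positivity
  set β := 1 - 2 * (1 / D) with hβ
  have hβ0 : 1 / 3 ≤ β := by linarith
  obtain ⟨W, hW, hs⟩ := exists_isPairing_of_close_pair SignedParam.Admissible
    (fun p q => paramDist p q ^ 2) (fun n => 12544 * (n : ℝ) ^ (β - 1)) (by
      intro k hk l hl hlen
      obtain ⟨a, b, l', hl', h⟩ := exists_close_pair hd hk l hl hlen
      refine ⟨a, b, l', hl', ?_⟩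
      have hk1 : (1 : ℝ) ≤ k := by exact_mod_cast hk
      have h1 := paramDist_le_norm_flatParam_sub (hl a (hl'.mem_iff.2 (by simp)))
        (hl b (hl'.mem_iff.2 (by simp)))
      have h2 : (k : ℝ) ^ (-(1 / (d : ℝ))) ≤ (k : ℝ) ^ (-(1 / D)) := by
        refine Real.rpow_le_rpow_of_exponent_le hk1 (neg_le_neg ?_)
        exact one_div_le_one_div_of_le (by exact_mod_cast hd) hdD
      have h3 : (k : ℝ) ^ (β - 1) = ((k : ℝ) ^ (-(1 / D))) ^ 2 := by
        rw [← Real.rpow_natCast, ← Real.rpow_mul (by positivity)]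
        congr 1; rw [hβ]; push_cast; ring
      rw [h3]
      have h4 : paramDist a b ≤ 112 * (k : ℝ) ^ (-(1 / D)) := by linarith
      calc paramDist a b ^ 2 ≤ (112 * (k : ℝ) ^ (-(1 / D))) ^ 2 :=
            pow_le_pow_left₀ (paramDist_nonneg _ _) h4 2
        _ = _ := by ring) n l hl hlen
  refine ⟨W, hW, hs.trans ?_⟩
  rw [← Finset.mul_sum]
  have h1 := sum_rpow_sub_one_le (by linarith : 0 < β) (by linarith) n
  have hn0 : (0 : ℝ) < n := by exact_mod_cast hn
  have h2 : (n : ℝ) ^ β / β ≤ 3 * (n : ℝ) ^ β := by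
    rw [div_le_iff₀ (by linarith)]
    have : 0 < (n : ℝ) ^ β := by positivity
    nlinarith
  have h3 : ((n : ℝ) ^ (1 / 2 - 1 / D)) ^ 2 = (n : ℝ) ^ β := by
    rw [← Real.rpow_natCast, ← Real.rpow_mul hn0.le]
    congr 1; rw [hβ]; push_cast; ring
  rw [mul_pow, h3]
  have : 0 < (n : ℝ) ^ β := by positivity
  linarith

/-! ### Short paths through a triangle, for pairings in the plane. -/

section Path
variable {α V : Type*} [NormedAddCommGroup V]

/-- The sum of the squared edge lengths of the path from `A` to `B` through the points of a list. -/
def pathCost (w : α → V) (B : V) : V → List α → ℝ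
  | A, [] => ‖A - B‖ ^ 2
  | A, p :: l => ‖A - w p‖ ^ 2 + pathCost w B (w p) l

theorem pathCost_nonneg (w : α → V) (A B : V) (l : List α) : 0 ≤ pathCost w B A l := by
  induction l generalizing A with
  | nil => simp only [pathCost]; positivity
  | cons p l ih => simp only [pathCost]; have := ih (w p); positivity

/-- Two paths meeting at `C` may be joined by skipping `C`, provided `C` is seen at no acute angle
from the two sides: the new edge then costs no more than the two it replaces. -/
theorem pathCost_append_le (w : α → V) (B C : V) (l₂ : List α) :
    ∀ (l₁ : List α) (A : V),
      (∀ q : V, q = B ∨ (∃ z ∈ l₂, q = w z) → ‖A - q‖ ^ 2 ≤ ‖A - C‖ ^ 2 + ‖C - q‖ ^ 2) →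
      (∀ p ∈ l₁, ∀ q : V, q = B ∨ (∃ z ∈ l₂, q = w z) →
        ‖w p - q‖ ^ 2 ≤ ‖w p - C‖ ^ 2 + ‖C - q‖ ^ 2) →
      pathCost w B A (l₁ ++ l₂) ≤ pathCost w C A l₁ + pathCost w B C l₂ := by
  intro l₁
  induction l₁ with
  | nil =>
    intro A hA _
    cases l₂ with
    | nil => exact hA B (Or.inl rfl)
    | cons q l =>
      simp only [List.nil_append, pathCost]
      have := hA (w q) (Or.inr ⟨q, by simp, rfl⟩)
      linarith
  | cons p l ih =>
    intro A _ h
    simp only [List.cons_append, pathCost]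
    have := ih (w p) (h p (by simp)) fun p' hp' => h p' (by simp [hp'])
    linarith

theorem pathCost_le_of_forall_le (w : α → V) (B : V) {H : ℝ} (l : List α) :
    ∀ A : V, (∀ p q : V, (p = A ∨ ∃ z ∈ l, p = w z) → (q = B ∨ ∃ z ∈ l, q = w z) →
      ‖p - q‖ ^ 2 ≤ H) → pathCost w B A l ≤ (l.length + 1) * H := by
  induction l with
  | nil => intro A h; simpa [pathCost] using h A B (Or.inl rfl) (Or.inl rfl)
  | cons p l ih =>
    intro A h
    have h1 := h A (w p) (Or.inl rfl) (Or.inr ⟨p, by simp, rfl⟩)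
    have h2 := ih (w p) fun p' q' hp' hq' => by
      refine h p' q' (Or.inr ?_) ?_
      · rcases hp' with rfl | ⟨z, hz, rfl⟩
        · exact ⟨p, by simp, rfl⟩
        · exact ⟨z, by simp [hz], rfl⟩
      · rcases hq' with rfl | ⟨z, hz, rfl⟩
        · exact Or.inl rfl
        · exact Or.inr ⟨z, by simp [hz], rfl⟩
    simp only [pathCost, List.length_cons]
    push_cast
    linarith

/-- Every second edge of the path is used as a pair; the others are dropped. -/
theorem exists_isPairing_le_pathCost (w : α → V) (B : V) (n : ℕ) :
    ∀ (l : List α) (A : V), l.length = 2 * n →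
      ∃ W, IsPairing l W ∧ (W.map fun p => ‖w p.1 - w p.2‖ ^ 2).sum ≤ pathCost w B A l := by
  induction n with
  | zero =>
    intro l A hl
    obtain rfl := List.length_eq_zero_iff.1 hl
    exact ⟨[], List.Perm.nil, by simpa using pathCost_nonneg w A B []⟩
  | succ n ih =>
    intro l A hl
    match l, hl with
    | a :: b :: l, hl =>
      obtain ⟨W, hW, hs⟩ := ih l (w b) (by simp at hl; omega)
      refine ⟨(a, b) :: W, hW.cons (List.Perm.refl _), ?_⟩
      simp only [List.map_cons, List.sum_cons, pathCost]
      have : 0 ≤ ‖A - w a‖ ^ 2 := by positivity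
      linarith
    | [a], hl => simp at hl; omega
    | [], hl => simp at hl

/-- The triangle with the vertices `A`, `B`, `C`. -/
def InTriangle [Module ℝ V] (A B C p : V) : Prop :=
  ∃ α β : ℝ, 0 ≤ α ∧ 0 ≤ β ∧ α + β ≤ 1 ∧ p = C + α • (A - C) + β • (B - C)

end Path

section Triangle
variable {α V : Type*} [NormedAddCommGroup V] [InnerProductSpace ℝ V]

/-- Seen from the right-angled vertex `C`, two points of the triangle span an angle of at most a
right angle, so their inner product is nonnegative. -/
theorem InTriangle.norm_sub_sq_le {A B C p q : V} (hright : inner ℝ (A - C) (B - C) = 0)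
    (hp : InTriangle A B C p) (hq : InTriangle A B C q) :
    ‖p - q‖ ^ 2 ≤ ‖p - C‖ ^ 2 + ‖C - q‖ ^ 2 := by
  obtain ⟨α, β, hα, hβ, -, rfl⟩ := hp
  obtain ⟨α', β', hα', hβ', -, rfl⟩ := hq
  have h : 0 ≤ inner ℝ (α • (A - C) + β • (B - C)) (α' • (A - C) + β' • (B - C)) := by
    have h' : inner ℝ (B - C) (A - C) = 0 := by rw [real_inner_comm]; exact hright
    simp only [inner_add_left, inner_add_right, inner_smul_left, inner_smul_right, hright, h',
      real_inner_self_eq_norm_sq, conj_trivial]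
    have : 0 ≤ ‖A - C‖ ^ 2 := by positivity
    have : 0 ≤ ‖B - C‖ ^ 2 := by positivity
    positivity
  have e := norm_sub_sq_real (α • (A - C) + β • (B - C)) (α' • (A - C) + β' • (B - C))
  rw [norm_sub_rev C]
  have e1 : C + α • (A - C) + β • (B - C) - C = α • (A - C) + β • (B - C) := by abel
  have e2 : C + α' • (A - C) + β' • (B - C) - C = α' • (A - C) + β' • (B - C) := by abel
  have e3 : C + α • (A - C) + β • (B - C) - (C + α' • (A - C) + β' • (B - C)) =
      (α • (A - C) + β • (B - C)) - (α' • (A - C) + β' • (B - C)) := by abel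
  rw [e1, e2, e3, e]
  linarith

theorem InTriangle.norm_sub_apex_sq_le {A B C p : V} (hright : inner ℝ (A - C) (B - C) = 0)
    (hiso : ‖A - C‖ = ‖B - C‖) (hp : InTriangle A B C p) : ‖p - C‖ ^ 2 ≤ ‖A - C‖ ^ 2 := by
  obtain ⟨α, β, hα, hβ, h1, rfl⟩ := hp
  rw [show C + α • (A - C) + β • (B - C) - C = α • (A - C) + β • (B - C) by abel,
    norm_add_sq_real, inner_smul_left, inner_smul_right, hright, norm_smul, norm_smul, ← hiso,
    mul_pow, mul_pow]
  have : 0 ≤ ‖A - C‖ ^ 2 := by positivity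
  simp only [Real.norm_eq_abs, sq_abs, mul_zero, add_zero]
  have hsq : α ^ 2 + β ^ 2 ≤ 1 := by nlinarith [mul_nonneg hα hβ]
  nlinarith

theorem inTriangle_left (A B C : V) : InTriangle A B C A :=
  ⟨1, 0, by norm_num, le_rfl, by norm_num, by simp⟩

theorem inTriangle_right (A B C : V) : InTriangle A B C B :=
  ⟨0, 1, le_rfl, by norm_num, by norm_num, by simp⟩

theorem norm_hypotenuse_sq {A B C : V} (hright : inner ℝ (A - C) (B - C) = 0)
    (hiso : ‖A - C‖ = ‖B - C‖) : ‖A - B‖ ^ 2 = 2 * ‖A - C‖ ^ 2 := by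
  rw [← sub_sub_sub_cancel_right A B C, norm_sub_sq_real, hright, ← hiso]; ring

theorem InTriangle.bisect {A B C p : V} (hp : InTriangle A B C p) :
    InTriangle A C ((2⁻¹ : ℝ) • (A + B)) p ∨ InTriangle C B ((2⁻¹ : ℝ) • (A + B)) p := by
  obtain ⟨α, β, hα, hβ, h1, rfl⟩ := hp
  rcases le_total β α with h | h
  · refine Or.inl ⟨α - β, 1 - α - β, by linarith, by linarith, by linarith, ?_⟩
    module
  · refine Or.inr ⟨1 - α - β, β - α, by linarith, by linarith, by linarith, ?_⟩
    module

theorem InTriangle.of_bisect_left {A B C p : V}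
    (hp : InTriangle A C ((2⁻¹ : ℝ) • (A + B)) p) : InTriangle A B C p := by
  obtain ⟨α, β, hα, hβ, h1, rfl⟩ := hp
  refine ⟨(1 + α - β) / 2, (1 - α - β) / 2, by linarith, by linarith, by linarith, ?_⟩
  module

theorem InTriangle.of_bisect_right {A B C p : V}
    (hp : InTriangle C B ((2⁻¹ : ℝ) • (A + B)) p) : InTriangle A B C p := by
  obtain ⟨α, β, hα, hβ, h1, rfl⟩ := hp
  refine ⟨(1 - α - β) / 2, (1 + β - α) / 2, by linarith, by linarith, by linarith, ?_⟩
  module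

theorem bisect_isosceles_right {A B C : V} (hright : inner ℝ (A - C) (B - C) = 0)
    (hiso : ‖A - C‖ = ‖B - C‖) :
    inner ℝ (A - (2⁻¹ : ℝ) • (A + B)) (C - (2⁻¹ : ℝ) • (A + B)) = 0 ∧
      ‖A - (2⁻¹ : ℝ) • (A + B)‖ = ‖C - (2⁻¹ : ℝ) • (A + B)‖ := by
  have e1 : A - (2⁻¹ : ℝ) • (A + B) = (2⁻¹ : ℝ) • ((A - C) - (B - C)) := by module
  have e2 : C - (2⁻¹ : ℝ) • (A + B) = -((2⁻¹ : ℝ) • ((A - C) + (B - C))) := by module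
  rw [e1, e2, inner_neg_right, norm_neg, norm_smul, norm_smul]
  constructor
  · rw [inner_smul_left, inner_smul_right, real_inner_comm, real_inner_add_sub_eq_zero_iff _ _ |>.2 hiso]
    simp
  · congr 1
    have h1 := norm_sub_sq_real (A - C) (B - C)
    have h2 := norm_add_sq_real (A - C) (B - C)
    rw [hright] at h1 h2
    rw [← sq_eq_sq₀ (norm_nonneg _) (norm_nonneg _), h1, h2]; ring

/-- The altitude from `C` splits the triangle into two similar ones with hypotenuses `AC` and `CB`,
and by Pythagoras their squares add up to that of `AB`. The main term is therefore preserved when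
the two paths are joined at `C`, while the error per point halves with each bisection. -/
theorem exists_perm_pathCost_le (w : α → V) (k : ℕ) :
    ∀ (A B C : V), inner ℝ (A - C) (B - C) = 0 → ‖A - C‖ = ‖B - C‖ →
      ∀ l : List α, (∀ z ∈ l, InTriangle A B C (w z)) →
        ∃ l', l'.Perm l ∧
          pathCost w B A l' ≤ ‖A - B‖ ^ 2 + l.length * (‖A - B‖ ^ 2 * (1 / 2) ^ k) := by
  classical
  induction k with
  | zero =>
    intro A B C hright hiso l hl
    refine ⟨l, List.Perm.refl _, ?_⟩
    refine (pathCost_le_of_forall_le w B (H := ‖A - B‖ ^ 2) l A fun p q hp hq => ?_).trans_eq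
      (by ring)
    have hp' : InTriangle A B C p := by
      rcases hp with rfl | ⟨z, hz, rfl⟩
      exacts [inTriangle_left _ _ _, hl z hz]
    have hq' : InTriangle A B C q := by
      rcases hq with rfl | ⟨z, hz, rfl⟩
      exacts [inTriangle_right _ _ _, hl z hz]
    have h1 := hp'.norm_sub_sq_le hright hq'
    have h2 := hp'.norm_sub_apex_sq_le hright hiso
    have h3 := hq'.norm_sub_apex_sq_le hright hiso
    rw [norm_sub_rev C] at h1
    rw [norm_hypotenuse_sq hright hiso]
    linarith
  | succ k ih =>
    intro A B C hright hiso l hl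
    set M := (2⁻¹ : ℝ) • (A + B) with hM
    obtain ⟨hr1, hi1⟩ := bisect_isosceles_right hright hiso
    have hr2 : inner ℝ (C - M) (B - M) = 0 := by
      have := bisect_isosceles_right (A := B) (B := A) (C := C)
        (by rw [real_inner_comm]; exact hright) hiso.symm
      rw [add_comm B A] at this
      rw [real_inner_comm]; exact this.1
    have hi2 : ‖C - M‖ = ‖B - M‖ := by
      have := bisect_isosceles_right (A := B) (B := A) (C := C)
        (by rw [real_inner_comm]; exact hright) hiso.symm
      rw [add_comm B A] at this
      exact this.2.symm
    set l₁ := l.filter fun z => InTriangle A C M (w z) with hl₁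
    set l₂ := l.filter fun z => !decide (InTriangle A C M (w z)) with hl₂
    have hperm : (l₁ ++ l₂).Perm l := List.filter_append_perm _ l
    have h₁ : ∀ z ∈ l₁, InTriangle A C M (w z) := fun z hz => by
      simpa using (List.mem_filter.1 hz).2
    have h₂ : ∀ z ∈ l₂, InTriangle C B M (w z) := fun z hz => by
      have := (List.mem_filter.1 hz).2
      simp only [Bool.not_eq_eq_eq_not, Bool.not_true, decide_eq_false_iff_not] at this
      exact (hl z (List.mem_filter.1 hz).1).bisect.resolve_left this
    obtain ⟨m₁, hm₁, hc₁⟩ := ih A C M hr1 hi1 l₁ h₁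
    obtain ⟨m₂, hm₂, hc₂⟩ := ih C B M hr2 hi2 l₂ h₂
    refine ⟨m₁ ++ m₂, (hm₁.append hm₂).trans hperm, ?_⟩
    have hq : ∀ q : V, q = B ∨ (∃ z ∈ m₂, q = w z) → InTriangle A B C q := by
      rintro q (rfl | ⟨z, hz, rfl⟩)
      · exact inTriangle_right _ _ _
      · exact (h₂ z (hm₂.mem_iff.1 hz)).of_bisect_right
    have happ := pathCost_append_le w B C m₂ m₁ A
      (fun q hq' => (inTriangle_left A B C).norm_sub_sq_le hright (hq q hq'))
      (fun p hp q hq' => (h₁ p (hm₁.mem_iff.1 hp)).of_bisect_left.norm_sub_sq_le hright (hq q hq'))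
    have hlen : (l.length : ℝ) = l₁.length + l₂.length := by
      rw [← hperm.length_eq, List.length_append]; push_cast; ring
    have hH := norm_hypotenuse_sq hright hiso
    rw [norm_sub_rev C B, ← hiso] at hc₂
    rw [hH, hlen, pow_succ]
    refine happ.trans ((add_le_add hc₁ hc₂).trans_eq ?_)
    ring

end Triangle

theorem exists_isPairing_of_inTriangle {α V : Type*} [NormedAddCommGroup V]
    [InnerProductSpace ℝ V] (w : α → V) {A B C : V}
    (hright : inner ℝ (A - C) (B - C) = 0) (hiso : ‖A - C‖ = ‖B - C‖) {n : ℕ} (l : List α)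
    (hl : ∀ z ∈ l, InTriangle A B C (w z)) (hlen : l.length = 2 * n) :
    ∃ W, IsPairing l W ∧ (W.map fun p => ‖w p.1 - w p.2‖ ^ 2).sum ≤ 2 * ‖A - B‖ ^ 2 := by
  -- With as many bisections as there are points, the error term is at most `‖A - B‖ ^ 2`.
  obtain ⟨l', hl', hc⟩ := exists_perm_pathCost_le w l.length A B C hright hiso l hl
  obtain ⟨W, hW, hs⟩ := exists_isPairing_le_pathCost w B n l' A (hl'.length_eq.trans hlen)
  refine ⟨W, List.Perm.trans hW hl', hs.trans (hc.trans ?_)⟩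
  have h1 : (l.length : ℝ) * (1 / 2) ^ l.length ≤ 1 := by
    have h2 : (l.length : ℝ) ≤ 2 ^ l.length := by exact_mod_cast Nat.lt_two_pow_self.le
    rw [one_div, inv_pow, ← div_eq_mul_inv]
    exact div_le_one_of_le₀ h2 (by positivity)
  have h3 : 0 ≤ ‖A - B‖ ^ 2 := by positivity
  nlinarith

theorem exists_isPairing_two {n : ℕ} (l : List (SignedParam 2))
    (hl : ∀ z ∈ l, z.Admissible) (hlen : l.length = 2 * n) :
    ∃ W, IsPairing l W ∧ (W.map fun p => paramDist p.1 p.2 ^ 2).sum ≤ 224 ^ 2 := by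
  let w : SignedParam 2 → ℂ := fun z => ⟨flatParam z 0, flatParam z 1⟩
  have hsq : ∀ u v : ℂ, ‖u - v‖ ^ 2 = (u.re - v.re) ^ 2 + (u.im - v.im) ^ 2 := fun u v => by
    rw [← Complex.normSq_eq_norm_sq, Complex.normSq_apply]; simp; ring
  -- This right isosceles triangle contains the `ℓ¹` ball of radius 4, where the flattened
  -- parameters lie.
  obtain ⟨W, hW, hs⟩ := exists_isPairing_of_inTriangle w (A := ⟨8, 4⟩) (B := ⟨-8, 4⟩)
    (C := ⟨0, -4⟩) (by rw [Complex.inner]; simp; norm_num) (by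
      rw [← sq_eq_sq₀ (norm_nonneg _) (norm_nonneg _), hsq, hsq]; norm_num) l (by
      intro z hz
      have h := norm_flatParam_le (hl z hz)
      rw [norm_l1_eq, Fin.sum_univ_two] at h
      set x := flatParam z 0
      set y := flatParam z 1
      have h1 := le_abs_self x
      have h2 := neg_le_abs x
      have h3 := le_abs_self y
      have h4 := neg_le_abs y
      refine ⟨(x + y + 4) / 16, (y + 4 - x) / 16, by linarith, by linarith, by linarith, ?_⟩
      apply Complex.ext <;> simp [w, x, y] <;> ring) hlen
  refine ⟨W, hW, ?_⟩
  rw [hsq] at hs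
  -- The factor is `98 = 7 ^ 2 * 2`, the 2 from comparing the `ℓ¹` and Euclidean norms in the plane.
  calc (W.map fun p => paramDist p.1 p.2 ^ 2).sum
      ≤ (W.map fun p => 98 * ‖w p.1 - w p.2‖ ^ 2).sum := by
        refine List.sum_le_sum fun p hp => ?_
        have h := paramDist_le_norm_flatParam_sub (hl _ (hW.mem hp).1) (hl _ (hW.mem hp).2)
        refine (pow_le_pow_left₀ (paramDist_nonneg _ _) h 2).trans ?_
        rw [hsq, norm_l1_eq, Fin.sum_univ_two, mul_pow]
        simp only [PiLp.sub_apply, w]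
        have h1 := sq_abs (flatParam p.1 0 - flatParam p.2 0)
        have h2 := sq_abs (flatParam p.1 1 - flatParam p.2 1)
        nlinarith [sq_nonneg (|flatParam p.1 0 - flatParam p.2 0| -
          |flatParam p.1 1 - flatParam p.2 1|)]
    _ = 98 * (W.map fun p => ‖w p.1 - w p.2‖ ^ 2).sum := by rw [List.sum_map_mul_left]
    _ ≤ 98 * (2 * ((8 - -8) ^ 2 + (4 - 4) ^ 2)) := by gcongr
    _ ≤ 224 ^ 2 := by norm_num

/-! ### Halving and iteration. -/

/-- The average of the signed ridge functions with parameters in the list `l`. -/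
noncomputable def ridgeAverage {d : ℕ} (s : ℕ) (l : List (SignedParam d)) (x : Fin d → ℝ) : ℝ :=
  (l.map fun z => signedRidge s z x).sum / l.length

/-- The factor `√(d + log n)` for `s = 2`, and `√d` otherwise. -/
noncomputable def rateFactor (s d n : ℕ) : ℝ :=
  if s = 2 then Real.sqrt (d + Real.log n) else Real.sqrt d

/-- The convergence rate, with an effective dimension `D`. -/
noncomputable def ridgeRate (s d : ℕ) (D : ℝ) (n : ℕ) : ℝ :=
  rateFactor s d n * (n : ℝ) ^ (-(1 / 2 : ℝ) - 1 / D)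

/-- Every list of `2 n` admissible parameters can be arranged in pairs whose squared distances
have a sum of order `n ^ (1 - 2 / D)`. -/
def HasClosePairings (d : ℕ) (D : ℝ) : Prop :=
  ∀ n : ℕ, 1 ≤ n → ∀ l : List (SignedParam d), (∀ z ∈ l, z.Admissible) → l.length = 2 * n →
    ∃ W, IsPairing l W ∧ (W.map fun p => paramDist p.1 p.2 ^ 2).sum ≤
      (224 * (n : ℝ) ^ (1 / 2 - 1 / D)) ^ 2

theorem hasClosePairings_of_three_le {d : ℕ} (hd : 1 ≤ d) {D : ℝ} (hD : 3 ≤ D) (hdD : d ≤ D) :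
    HasClosePairings d D :=
  fun _ hn l hl hlen => exists_isPairing_of_three_le hd hD hdD hn l hl hlen

theorem hasClosePairings_two : HasClosePairings 2 2 := fun n _ l hl hlen => by
  obtain ⟨W, hW, hs⟩ := exists_isPairing_two l hl hlen
  exact ⟨W, hW, by simpa using hs⟩

theorem exists_signs_ridge_le {d s : ℕ} (hd : 1 ≤ d) (hs : s = 2 ∨ s = 3) {D : ℝ}
    (hdD : d ≤ D) {n : ℕ} (hn : 1 ≤ n) (W : Fin n → SignedParam d × SignedParam d)
    (hW : ∀ i, (W i).1.Admissible ∧ (W i).2.Admissible)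
    (hsum : ∑ i, paramDist (W i).1 (W i).2 ^ 2 ≤ (224 * (n : ℝ) ^ (1 / 2 - 1 / D)) ^ 2) :
    ∃ ε : Fin n → Bool, ∀ x ∈ cube d,
      |signedSum ε fun i => signedRidge s (W i).1 x - signedRidge s (W i).2 x| ≤
        49280 * (n : ℝ) ^ (1 / 2 - 1 / D) * rateFactor s d n := by
  have hn0 : (0 : ℝ) < n := by exact_mod_cast hn
  have hd1 : (1 : ℝ) ≤ d := by exact_mod_cast hd
  have hD0 : 0 < D := by linarith
  set T := (n : ℝ) ^ (1 / 2 - 1 / D) with hT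
  have hT0 : 0 < T := by positivity
  let G : (Fin d → ℝ) → Fin n → ℝ := fun x i =>
    signedRidge s (W i).1 x - signedRidge s (W i).2 x
  have hG : ∀ x ∈ cube d, ∑ i, G x i ^ 2 ≤ (448 * T) ^ 2 := by
    intro x hx
    calc ∑ i, G x i ^ 2 ≤ ∑ i, 4 * paramDist (W i).1 (W i).2 ^ 2 := by
          refine Finset.sum_le_sum fun i _ => ?_
          have h := abs_signedRidge_sub_le_paramDist hs (hW i).1 (hW i).2 hx
          rw [← sq_abs]
          calc _ ≤ (2 * paramDist (W i).1 (W i).2) ^ 2 := pow_le_pow_left₀ (abs_nonneg _) h 2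
            _ = _ := by ring
      _ ≤ _ := by rw [← Finset.mul_sum]; nlinarith
  rcases hs with rfl | rfl
  -- The Lipschitz constant is only `4 √n`, which exceeds `T` by the factor `n ^ (1 / D)` up to
  -- constants. The base mesh `2 ^ (-k₀) ≤ n ^ (-1 / D)` compensates for it, and `d ≤ D` keeps `d *
  -- k₀` of order `d + log n`.
  · set k₀ := ⌈Real.logb 2 n / D⌉₊ with hk₀
    have hlog0 : 0 ≤ Real.logb 2 n := Real.logb_nonneg (by norm_num) (by exact_mod_cast hn)
    have hpow : (n : ℝ) ^ (1 / D) ≤ 2 ^ k₀ := by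
      have h1 : (n : ℝ) ^ (1 / D) = (2 : ℝ) ^ (Real.logb 2 n / D) := by
        rw [div_eq_mul_one_div (Real.logb 2 n) D, Real.rpow_mul (by norm_num),
          Real.rpow_logb (by norm_num) (by norm_num) hn0]
      rw [h1, ← Real.rpow_natCast]
      exact Real.rpow_le_rpow_of_exponent_le (by norm_num) (Nat.le_ceil _)
    have hsqrt : Real.sqrt n = T * (n : ℝ) ^ (1 / D) := by
      rw [hT, ← Real.rpow_add hn0, Real.sqrt_eq_rpow]; congr 1; ring
    have hLip : ∀ x ∈ cube d, ∀ y ∈ cube d,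
        ∑ i, (G x i - G y i) ^ 2 ≤ (4 * Real.sqrt n * dist x y) ^ 2 := by
      intro x hx y hy
      calc ∑ i, (G x i - G y i) ^ 2 ≤ ∑ _i : Fin n, (4 * dist x y) ^ 2 := by
            refine Finset.sum_le_sum fun i _ => ?_
            have h1 := abs_signedRidge_sub_le_dist (Or.inl rfl) (hW i).1 hx hy
            have h2 := abs_signedRidge_sub_le_dist (Or.inl rfl) (hW i).2 hx hy
            rw [← sq_abs]
            refine pow_le_pow_left₀ (abs_nonneg _) ?_ 2
            simp only [G]
            rw [sub_sub_sub_comm]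
            refine (abs_sub _ _).trans ?_
            linarith
        _ = _ := by
            rw [Finset.sum_const, Finset.card_univ, Fintype.card_fin, nsmul_eq_mul, mul_pow,
              mul_pow, mul_pow, Real.sq_sqrt hn0.le]
            ring
    obtain ⟨ε, hε⟩ := exists_signs_sup_le hd G (by positivity) (by positivity) k₀ hG hLip (by
      rw [hsqrt]
      have h2 : (2 : ℝ) ^ k₀ * (1 / 2) ^ k₀ = 1 := by rw [← mul_pow]; norm_num
      calc 4 * (T * (n : ℝ) ^ (1 / D)) * (1 / 2) ^ k₀ ≤ 4 * (T * 2 ^ k₀) * (1 / 2) ^ k₀ := by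
            gcongr
        _ = 4 * T * (2 ^ k₀ * (1 / 2) ^ k₀) := by ring
        _ ≤ 448 * T := by rw [h2]; linarith)
    refine ⟨ε, fun x hx => (hε x hx).trans ?_⟩
    have hfac : Real.sqrt (d * (k₀ + 1)) ≤ 2 * rateFactor 2 d n := by
      rw [rateFactor, if_pos rfl]
      have hl0 : 0 ≤ Real.log n := Real.log_nonneg (by exact_mod_cast hn)
      refine Real.sqrt_le_iff.2 ⟨by positivity, ?_⟩
      rw [mul_pow, Real.sq_sqrt (by positivity)]
      have h1 : (k₀ : ℝ) ≤ Real.logb 2 n / D + 1 := (Nat.ceil_lt_add_one (by positivity)).le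
      have h2 : d * (Real.logb 2 n / D) ≤ Real.logb 2 n := by
        rw [mul_div_assoc', div_le_iff₀ hD0, mul_comm]
        gcongr
      have h3 : Real.logb 2 n ≤ 2 * Real.log n := by
        rw [Real.logb, div_le_iff₀ (Real.log_pos (by norm_num))]
        nlinarith [Real.log_two_gt_d9]
      nlinarith
    calc _ ≤ 55 * (448 * T) * (2 * rateFactor 2 d n) := by gcongr
      _ = _ := by ring
  · have hLip : ∀ x ∈ cube d, ∀ y ∈ cube d,
        ∑ i, (G x i - G y i) ^ 2 ≤ (896 * T * dist x y) ^ 2 := by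
      intro x hx y hy
      calc ∑ i, (G x i - G y i) ^ 2
          ≤ ∑ i, (4 * dist x y) ^ 2 * paramDist (W i).1 (W i).2 ^ 2 := by
            refine Finset.sum_le_sum fun i _ => ?_
            have h := abs_signedRidge_three_mixed_sub_le (hW i).1 (hW i).2 hx hy
            rw [← sq_abs, ← mul_pow]
            refine pow_le_pow_left₀ (abs_nonneg _) (h.trans_eq ?_) 2
            ring
        _ ≤ (4 * dist x y) ^ 2 * (224 * T) ^ 2 := by rw [← Finset.mul_sum]; gcongr
        _ = _ := by ring
    -- The pointwise bound is relaxed from `448 T` to `896 T` to match the Lipschitz constant, so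
    -- that `k₀ = 0` is allowed.
    obtain ⟨ε, hε⟩ := exists_signs_sup_le hd G (A := 896 * T) (by positivity) (by positivity) 0
      (fun x hx => (hG x hx).trans (by gcongr; norm_num)) hLip (by simp)
    refine ⟨ε, fun x hx => (hε x hx).trans_eq ?_⟩
    rw [rateFactor, if_neg (by norm_num)]
    simp only [Nat.cast_zero, zero_add, mul_one]
    ring

theorem exists_half_list {d s : ℕ} (hd : 1 ≤ d) (hs : s = 2 ∨ s = 3) {D : ℝ}
    (hdD : d ≤ D) (hP : HasClosePairings d D) {n : ℕ} (hn : 1 ≤ n) (l : List (SignedParam d))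
    (hl : ∀ z ∈ l, z.Admissible) (hlen : l.length = 2 * n) :
    ∃ l' : List (SignedParam d), (∀ z ∈ l', z.Admissible) ∧ l'.length = n ∧
      ∀ x ∈ cube d, |ridgeAverage s l x - ridgeAverage s l' x| ≤ 24640 * ridgeRate s d D n := by
  obtain ⟨W, hW, hsum⟩ := hP n hn l hl hlen
  have hWlen : W.length = n := by have := hW.length; omega
  subst hWlen
  rw [← Fin.sum_univ_fun_getElem] at hsum
  have hadm : ∀ i : Fin W.length, (W[i.1]).1.Admissible ∧ (W[i.1]).2.Admissible := fun i =>
    ⟨hl _ (hW.mem (List.getElem_mem i.2)).1, hl _ (hW.mem (List.getElem_mem i.2)).2⟩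
  obtain ⟨ε, hε⟩ := exists_signs_ridge_le hd hs hdD hn (fun i => W[i.1]) hadm hsum
  refine ⟨List.ofFn fun i => if ε i then W[i.1].1 else W[i.1].2, ?_, by simp, fun x hx => ?_⟩
  · intro z hz
    obtain ⟨i, rfl⟩ := (List.mem_ofFn' _ _).1 hz
    simp only
    split_ifs
    exacts [(hadm i).1, (hadm i).2]
  have hn0 : (0 : ℝ) < W.length := by exact_mod_cast hn
  -- The sum over a pair is twice the kept term minus the signed difference, so only the signed sum
  -- survives.
  have key : ridgeAverage s l x - ridgeAverage s
      (List.ofFn fun i => if ε i then W[i.1].1 else W[i.1].2) x =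
      -(signedSum ε fun i : Fin W.length =>
        signedRidge s W[i.1].1 x - signedRidge s W[i.1].2 x) / (2 * W.length) := by
    unfold ridgeAverage signedSum
    rw [hW.sum, hlen, List.map_ofFn, List.sum_ofFn, List.length_ofFn, ← Fin.sum_univ_fun_getElem]
    push_cast
    rw [div_sub_div _ _ (by positivity) (by positivity),
      div_eq_div_iff (by positivity) (by positivity)]
    have : ∑ i : Fin W.length, (signedRidge s W[i.1].1 x + signedRidge s W[i.1].2 x) =
        2 * ∑ i : Fin W.length, ((fun z => signedRidge s z x) ∘
          fun i : Fin W.length => if ε i then W[i.1].1 else W[i.1].2) i -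
        ∑ i : Fin W.length, if ε i then signedRidge s W[i.1].1 x - signedRidge s W[i.1].2 x
          else -(signedRidge s W[i.1].1 x - signedRidge s W[i.1].2 x) := by
      rw [Finset.mul_sum, ← Finset.sum_sub_distrib]
      refine Finset.sum_congr rfl fun i _ => ?_
      simp only [Function.comp]
      split_ifs <;> ring
    rw [this]
    ring
  rw [key, abs_div, abs_neg, abs_of_pos (by positivity : (0 : ℝ) < 2 * W.length),
    div_le_iff₀ (by positivity)]
  refine (hε x hx).trans_eq ?_
  rw [ridgeRate, show (1 / 2 - 1 / D) = (-(1 / 2 : ℝ) - 1 / D) + 1 by ring,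
    Real.rpow_add_one hn0.ne']
  ring

theorem rateFactor_pos {s d n : ℕ} (hd : 1 ≤ d) (hn : 1 ≤ n) : 0 < rateFactor s d n := by
  have hd1 : (0 : ℝ) < d := by exact_mod_cast hd
  have hl0 : 0 ≤ Real.log n := Real.log_nonneg (by exact_mod_cast hn)
  unfold rateFactor
  split_ifs <;> positivity

theorem ridgeRate_pos {s d n : ℕ} (D : ℝ) (hd : 1 ≤ d) (hn : 1 ≤ n) : 0 < ridgeRate s d D n := by
  have hn0 : (0 : ℝ) < n := by exact_mod_cast hn
  have := rateFactor_pos (s := s) hd hn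
  unfold ridgeRate
  positivity

/-- The power of `n` gains at least `√(1 / 2)`, and the logarithmic factor loses at most `√1.7`
because `log 2 ≤ 0.7 d`; finally `√0.85 ≤ 0.93`. -/
theorem ridgeRate_two_mul_le {s d n : ℕ} {D : ℝ} (hd : 1 ≤ d) (hn : 1 ≤ n) (hD : 0 < D) :
    ridgeRate s d D (2 * n) ≤ 93 / 100 * ridgeRate s d D n := by
  have hn0 : (0 : ℝ) < n := by exact_mod_cast hn
  have hd1 : (1 : ℝ) ≤ d := by exact_mod_cast hd
  have hl0 : 0 ≤ Real.log n := Real.log_nonneg (by exact_mod_cast hn)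
  have h1 : rateFactor s d (2 * n) ≤ Real.sqrt 1.7 * rateFactor s d n := by
    unfold rateFactor
    split_ifs
    · rw [← Real.sqrt_mul (by norm_num)]
      refine Real.sqrt_le_sqrt ?_
      push_cast
      rw [Real.log_mul (by norm_num) hn0.ne']
      linarith [Real.log_two_lt_d9]
    · exact le_mul_of_one_le_left (Real.sqrt_nonneg _) (Real.one_le_sqrt.2 (by norm_num))
  have h2 : ((2 * n : ℕ) : ℝ) ^ (-(1 / 2 : ℝ) - 1 / D) ≤
      Real.sqrt (1 / 2) * (n : ℝ) ^ (-(1 / 2 : ℝ) - 1 / D) := by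
    push_cast
    rw [Real.mul_rpow (by norm_num) hn0.le, Real.sqrt_eq_rpow, one_div 2,
      Real.inv_rpow (by norm_num), ← Real.rpow_neg (by norm_num)]
    gcongr
    · norm_num
    · have : 0 < 1 / D := by positivity
      linarith
  have h3 : Real.sqrt 1.7 * Real.sqrt (1 / 2) ≤ 93 / 100 := by
    rw [← Real.sqrt_mul (by norm_num)]
    exact Real.sqrt_le_iff.2 ⟨by norm_num, by norm_num⟩
  have h0 := rateFactor_pos (s := s) hd hn
  unfold ridgeRate
  calc _ ≤ (Real.sqrt 1.7 * rateFactor s d n) *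
        (Real.sqrt (1 / 2) * (n : ℝ) ^ (-(1 / 2 : ℝ) - 1 / D)) := by gcongr
    _ = (Real.sqrt 1.7 * Real.sqrt (1 / 2)) *
        (rateFactor s d n * (n : ℝ) ^ (-(1 / 2 : ℝ) - 1 / D)) := by ring
    _ ≤ _ := by gcongr

/-- The constant is the fixed point of the recursion: `0.93 * 352000 + 24640 = 352000`. -/
theorem exists_list_of_two_pow_mul {d s : ℕ} (hd : 1 ≤ d) (hs : s = 2 ∨ s = 3) {D : ℝ}
    (hdD : d ≤ D) (hP : HasClosePairings d D) (j : ℕ) :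
    ∀ m : ℕ, 1 ≤ m → ∀ l : List (SignedParam d), (∀ z ∈ l, z.Admissible) →
      l.length = m * 2 ^ j →
      ∃ l' : List (SignedParam d), (∀ z ∈ l', z.Admissible) ∧ l'.length = m ∧
        ∀ x ∈ cube d, |ridgeAverage s l x - ridgeAverage s l' x| ≤ 352000 * ridgeRate s d D m := by
  have hD0 : 0 < D := by
    have : (1 : ℝ) ≤ d := by exact_mod_cast hd
    linarith
  induction j with
  | zero =>
    intro m hm l hl hlen
    refine ⟨l, hl, by simpa using hlen, fun x _ => ?_⟩
    rw [sub_self, abs_zero]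
    have := ridgeRate_pos (s := s) D hd hm
    positivity
  | succ j ih =>
    intro m hm l hl hlen
    obtain ⟨l₁, hl₁, hlen₁, h₁⟩ := ih (2 * m) (by omega) l hl (by rw [hlen]; ring)
    obtain ⟨l₂, hl₂, hlen₂, h₂⟩ := exists_half_list hd hs hdD hP hm l₁ hl₁ hlen₁
    refine ⟨l₂, hl₂, hlen₂, fun x hx => ?_⟩
    have h3 := ridgeRate_two_mul_le (s := s) hd hm hD0
    have h4 := abs_sub_le (ridgeAverage s l x) (ridgeAverage s l₁ x) (ridgeAverage s l₂ x)
    linarith [h₁ x hx, h₂ x hx]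

/-! ### From the measure to a finite list. -/

theorem exists_list_of_multiplicities {ι α : Type*} (S : Finset ι) (n : ι → ℕ) (z : ι → α) :
    ∃ l : List α, (∀ y ∈ l, ∃ i, y = z i) ∧ l.length = ∑ i ∈ S, n i ∧
      ∀ F : α → ℝ, (l.map F).sum = ∑ i ∈ S, n i * F (z i) := by
  classical
  induction S using Finset.induction_on with
  | empty => exact ⟨[], by simp, by simp, by simp⟩
  | insert i S hi ih =>
    obtain ⟨l, hl, hlen, hF⟩ := ih
    refine ⟨List.replicate (n i) (z i) ++ l, ?_, ?_, fun F => ?_⟩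
    · intro y hy
      rcases List.mem_append.1 hy with h | h
      exacts [⟨i, (List.eq_of_mem_replicate h)⟩, hl y h]
    · rw [List.length_append, List.length_replicate, hlen, Finset.sum_insert hi]
    · rw [List.map_append, List.sum_append, hF, Finset.sum_insert hi, List.map_replicate,
        List.sum_replicate, nsmul_eq_mul]

/-- Weights are rounded down and the whole deficit, at most the number of indices, is given to a
single index. -/
theorem exists_multiplicities {ι : Type*} [Fintype ι] (w : ι → ℝ) (h0 : ∀ i, 0 ≤ w i)
    (h1 : ∑ i, w i = 1) (N : ℕ) :
    ∃ n : ι → ℕ, ∑ i, n i = N ∧ ∑ i, |n i - N * w i| ≤ 2 * Fintype.card ι := by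
  classical
  have hne : Nonempty ι := by
    by_contra h
    rw [not_nonempty_iff] at h
    simp at h1
  obtain ⟨i₀⟩ := hne
  have hfl : ∀ i, ((⌊N * w i⌋₊ : ℕ) : ℝ) ≤ N * w i := fun i =>
    Nat.floor_le (mul_nonneg (Nat.cast_nonneg _) (h0 i))
  have hsum : ∑ i, (N : ℝ) * w i = N := by rw [← Finset.mul_sum, h1, mul_one]
  have hle : ∑ i, ⌊N * w i⌋₊ ≤ N := by
    have : ((∑ i, ⌊N * w i⌋₊ : ℕ) : ℝ) ≤ N := by
      push_cast
      exact (Finset.sum_le_sum fun i _ => hfl i).trans_eq hsum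
    exact_mod_cast this
  set r := N - ∑ i, ⌊N * w i⌋₊ with hr
  have hr' : (r : ℝ) = ∑ i, ((N : ℝ) * w i - (⌊N * w i⌋₊ : ℕ)) := by
    rw [Finset.sum_sub_distrib, hsum, hr, Nat.cast_sub hle]; push_cast; rfl
  have hrc : (r : ℝ) ≤ Fintype.card ι := by
    rw [hr']
    calc _ ≤ ∑ _i : ι, (1 : ℝ) :=
          Finset.sum_le_sum fun i _ => by linarith [Nat.lt_floor_add_one ((N : ℝ) * w i)]
      _ = _ := by simp
  refine ⟨fun i => ⌊N * w i⌋₊ + if i = i₀ then r else 0, ?_, ?_⟩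
  · rw [Finset.sum_add_distrib, Finset.sum_ite_eq' Finset.univ i₀, if_pos (Finset.mem_univ _)]
    omega
  · calc _ ≤ ∑ i, (((N : ℝ) * w i - (⌊N * w i⌋₊ : ℕ)) + if i = i₀ then (r : ℝ) else 0) := by
          refine Finset.sum_le_sum fun i _ => ?_
          have := hfl i
          have hr0 : (0 : ℝ) ≤ r := Nat.cast_nonneg _
          push_cast
          rw [abs_le]
          split_ifs <;> constructor <;> linarith
      _ = r + r := by
          rw [Finset.sum_add_distrib, ← hr', Finset.sum_ite_eq' Finset.univ i₀,
            if_pos (Finset.mem_univ _)]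
      _ ≤ _ := by linarith

section
variable {d s : ℕ} {P : Measure (paramSpace d)} {η : paramSpace d → ℝ}

/-- The signed parameter of a point of the parameter space. -/
def toSignedParam (η : paramSpace d → ℝ) (p : paramSpace d) : SignedParam d :=
  (η p, p.1.1, p.1.2)

theorem toSignedParam_admissible (hη : ∀ p, η p = -1 ∨ η p = 1) (p : paramSpace d) :
    (toSignedParam η p).Admissible := ⟨hη p, p.2.1, p.2.2⟩

theorem measurable_signedRidge_toSignedParam (hm : Measurable η) (x : Fin d → ℝ) :
    Measurable fun p => signedRidge s (toSignedParam η p) x := by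
  unfold signedRidge toSignedParam ridge
  fun_prop

theorem integrable_signedRidge [IsProbabilityMeasure P] (hm : Measurable η)
    (hη : ∀ p, η p = -1 ∨ η p = 1) {x : Fin d → ℝ} (hx : x ∈ cube d) :
    Integrable (fun p => signedRidge s (toSignedParam η p) x) P :=
  Integrable.of_bound (measurable_signedRidge_toSignedParam hm x).aestronglyMeasurable 1
    (Filter.Eventually.of_forall fun p => abs_signedRidge_le_one (toSignedParam_admissible hη p) hx)

/-- The integral of the vector of values at finitely many points lies in the closed convex hull of
the range, hence near a finite convex combination. -/
theorem exists_weights_approx_integral [IsProbabilityMeasure P] (hm : Measurable η)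
    (hη : ∀ p, η p = -1 ∨ η p = 1) (X : Finset (Fin d → ℝ)) (hX : ∀ x ∈ X, x ∈ cube d)
    {κ : ℝ} (hκ : 0 < κ) :
    ∃ (ι : Type) (_ : Fintype ι) (w : ι → ℝ) (p : ι → paramSpace d),
      (∀ i, 0 ≤ w i) ∧ ∑ i, w i = 1 ∧ ∀ x ∈ X,
        |∫ q, signedRidge s (toSignedParam η q) x ∂P -
          ∑ i, w i * signedRidge s (toSignedParam η (p i)) x| ≤ κ := by
  let Φ : paramSpace d → X → ℝ := fun q x => signedRidge s (toSignedParam η q) x.1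
  have hint : ∀ x : X, Integrable (fun q => Φ q x) P := fun x =>
    integrable_signedRidge hm hη (hX x.1 x.2)
  have hmem : ∫ q, Φ q ∂P ∈ closure (convexHull ℝ (Set.range Φ)) := by
    refine (convex_convexHull ℝ _).closure.integral_mem isClosed_closure
      (Filter.Eventually.of_forall fun q => subset_closure (subset_convexHull ℝ _ ⟨q, rfl⟩)) ?_
    exact Integrable.of_eval hint
  obtain ⟨y, hy, hdist⟩ := Metric.mem_closure_iff.1 hmem κ hκ
  obtain ⟨ι, hι, w, v, hw0, hw1, hv, rfl⟩ := mem_convexHull_iff_exists_fintype.1 hy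
  choose p hp using hv
  refine ⟨ι, hι, w, p, hw0, hw1, fun x hx => ?_⟩
  have h := (dist_le_pi_dist (∫ q, Φ q ∂P) (∑ i, w i • v i) ⟨x, hx⟩).trans hdist.le
  rw [Real.dist_eq, eval_integral hint] at h
  simpa only [Finset.sum_apply, Pi.smul_apply, smul_eq_mul, ← hp, Φ] using h

theorem abs_ridgeAverage_sub_le_dist {l : List (SignedParam d)} (hs : s = 2 ∨ s = 3)
    (hl : ∀ z ∈ l, z.Admissible) {x y : Fin d → ℝ} (hx : x ∈ cube d) (hy : y ∈ cube d) :
    |ridgeAverage s l x - ridgeAverage s l y| ≤ 2 * dist x y := by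
  have h : |(l.map fun z => signedRidge s z x).sum - (l.map fun z => signedRidge s z y).sum| ≤
      l.length * (2 * dist x y) := by
    induction l with
    | nil => simp
    | cons z l ih =>
      have h1 := abs_signedRidge_sub_le_dist hs (hl z (by simp)) hx hy
      have h2 := ih fun z' hz' => hl z' (by simp [hz'])
      simp only [List.map_cons, List.sum_cons, List.length_cons]
      rw [add_sub_add_comm]
      push_cast
      linarith [abs_add_le (signedRidge s z x - signedRidge s z y)
        ((l.map fun z => signedRidge s z x).sum - (l.map fun z => signedRidge s z y).sum)]
  unfold ridgeAverage
  rw [← sub_div, abs_div, Nat.abs_cast]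
  exact div_le_of_le_mul₀ (Nat.cast_nonneg _) (by positivity) (by linarith)

/-- The error `κ` is split into four quarters: moving to a grid point in the integral and in the
average, the convex combination, and the rounding of its weights to multiples of `1 / (m * 2 ^ j)`.
-/
theorem exists_list_approx_integral [IsProbabilityMeasure P] (hs : s = 2 ∨ s = 3)
    (hm : Measurable η) (hη : ∀ p, η p = -1 ∨ η p = 1) {m : ℕ} (hm1 : 1 ≤ m)
    {κ : ℝ} (hκ : 0 < κ) :
    ∃ (j : ℕ) (l : List (SignedParam d)), (∀ z ∈ l, z.Admissible) ∧ l.length = m * 2 ^ j ∧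
      ∀ x ∈ cube d,
        |∫ q, signedRidge s (toSignedParam η q) x ∂P - ridgeAverage s l x| ≤ κ := by
  obtain ⟨k, hk⟩ := exists_pow_lt_of_lt_one (by positivity : 0 < κ / 8)
    (by norm_num : (1 / 2 : ℝ) < 1)
  obtain ⟨ι, _, w, p, hw0, hw1, happ⟩ := exists_weights_approx_integral (s := s) (P := P) hm hη
    (dyadicGrid d k) (fun x hx => dyadicGrid_subset_cube hx) (by positivity : 0 < κ / 4)
  obtain ⟨j, hj⟩ := exists_pow_lt_of_lt_one
    (by positivity : 0 < κ / 4 / (2 * Fintype.card ι + 1)) (by norm_num : (1 / 2 : ℝ) < 1)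
  obtain ⟨n, hn, hnw⟩ := exists_multiplicities w hw0 hw1 (m * 2 ^ j)
  obtain ⟨l, hl, hlen, hF⟩ := exists_list_of_multiplicities Finset.univ n
    (fun i => toSignedParam η (p i))
  rw [hn] at hlen
  have hadm : ∀ z ∈ l, z.Admissible := fun z hz => by
    obtain ⟨i, rfl⟩ := hl z hz
    exact toSignedParam_admissible hη _
  refine ⟨j, l, hadm, hlen, fun x hx => ?_⟩
  obtain ⟨y, hy, hxy⟩ := exists_dyadicGrid_dist_le k hx
  have hyc := dyadicGrid_subset_cube hy
  have h1 : |∫ q, signedRidge s (toSignedParam η q) x ∂P -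
      ∫ q, signedRidge s (toSignedParam η q) y ∂P| ≤ 2 * dist x y := by
    rw [← integral_sub (integrable_signedRidge hm hη hx) (integrable_signedRidge hm hη hyc)]
    have := norm_integral_le_of_norm_le_const (μ := P) (C := 2 * dist x y)
      (f := fun q => signedRidge s (toSignedParam η q) x - signedRidge s (toSignedParam η q) y)
      (Filter.Eventually.of_forall fun q =>
        abs_signedRidge_sub_le_dist hs (toSignedParam_admissible hη q) hx hyc)
    simpa using this
  have h2 := abs_ridgeAverage_sub_le_dist hs hadm hx hyc
  have h3 := happ y hy
  set N : ℝ := ((m * 2 ^ j : ℕ) : ℝ) with hN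
  have hNj : (2 : ℝ) ^ j ≤ N := by
    rw [hN]; push_cast
    exact le_mul_of_one_le_left (by positivity) (by exact_mod_cast hm1)
  have hN0 : 0 < N := lt_of_lt_of_le (by positivity) hNj
  have h4 : |∑ i, w i * signedRidge s (toSignedParam η (p i)) y - ridgeAverage s l y| ≤ κ / 4 := by
    have e : ∑ i, w i * signedRidge s (toSignedParam η (p i)) y - ridgeAverage s l y =
        -(∑ i, ((n i : ℝ) - N * w i) * signedRidge s (toSignedParam η (p i)) y) / N := by
      unfold ridgeAverage
      rw [hF, hlen, ← hN, eq_div_iff hN0.ne', sub_mul, div_mul_cancel₀ _ hN0.ne', Finset.sum_mul,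
        ← Finset.sum_sub_distrib, ← Finset.sum_neg_distrib]
      exact Finset.sum_congr rfl fun i _ => by ring
    have b : |∑ i, ((n i : ℝ) - N * w i) * signedRidge s (toSignedParam η (p i)) y| ≤
        2 * Fintype.card ι := by
      refine (Finset.abs_sum_le_sum_abs _ _).trans ((Finset.sum_le_sum fun i _ => ?_).trans hnw)
      rw [abs_mul]
      exact mul_le_of_le_one_right (abs_nonneg _)
        (abs_signedRidge_le_one (toSignedParam_admissible hη _) hyc)
    rw [e, abs_div, abs_neg, abs_of_pos hN0, div_le_iff₀ hN0]
    have hc : (0 : ℝ) < 2 * Fintype.card ι + 1 := by positivity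
    rw [lt_div_iff₀ hc] at hj
    have h5 : (2 : ℝ) ^ j * (1 / 2) ^ j = 1 := by rw [← mul_pow]; norm_num
    calc _ ≤ (2 * Fintype.card ι + 1 : ℝ) := by linarith
      _ = 2 ^ j * ((1 / 2) ^ j * (2 * Fintype.card ι + 1)) := by rw [← mul_assoc, h5, one_mul]
      _ ≤ N * (κ / 4) := by gcongr
      _ = _ := mul_comm _ _
  rw [abs_le] at *
  constructor <;> linarith

theorem exists_list_ridgeRate [IsProbabilityMeasure P] (hd : 1 ≤ d) (hs : s = 2 ∨ s = 3)
    (hm : Measurable η) (hη : ∀ p, η p = -1 ∨ η p = 1) {D : ℝ} (hdD : d ≤ D)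
    (hP : HasClosePairings d D) {m : ℕ} (hm1 : 1 ≤ m) :
    ∃ l : List (SignedParam d), (∀ z ∈ l, z.Admissible) ∧ l.length = m ∧ ∀ x ∈ cube d,
      |∫ q, signedRidge s (toSignedParam η q) x ∂P - ridgeAverage s l x| ≤
        352001 * ridgeRate s d D m := by
  obtain ⟨j, l, hl, hlen, h⟩ := exists_list_approx_integral (P := P) hs hm hη hm1
    (ridgeRate_pos (s := s) D hd hm1)
  obtain ⟨l', hl', hlen', h'⟩ := exists_list_of_two_pow_mul hd hs hdD hP j m hm1 l hl hlen
  refine ⟨l', hl', hlen', fun x hx => ?_⟩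
  refine (abs_sub_le _ (ridgeAverage s l x) _).trans ?_
  linarith [h x hx, h' x hx]

theorem exists_ridgeComb_ridgeRate [IsProbabilityMeasure P] (hd : 1 ≤ d) (hs : s = 2 ∨ s = 3)
    (hm : Measurable η) (hη : ∀ p, η p = -1 ∨ η p = 1) {D : ℝ} (hdD : d ≤ D)
    (hP : HasClosePairings d D) {m : ℕ} (hm1 : 1 ≤ m) {v : ℝ} {f : (Fin d → ℝ) → ℝ}
    (hf : HasRidgeRepresentation s v P η f) :
    ∃ (b t : Fin m → ℝ) (a : Fin m → Fin d → ℝ), (∀ k, b k = -1 ∨ b k = 1) ∧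
      (∀ k, a k ∈ l1Sphere d) ∧ (∀ k, t k ∈ Set.Icc (0 : ℝ) 1) ∧
      ∀ x ∈ cube d, |f x - ridgeComb s v b t a x| ≤ 352001 * |v| * ridgeRate s d D m := by
  obtain ⟨l, hl, rfl, h⟩ := exists_list_ridgeRate (P := P) hd hs hm hη hdD hP hm1
  have hadm : ∀ k : Fin l.length, (l[k.1]).Admissible := fun k => hl _ (List.getElem_mem k.2)
  refine ⟨fun k => l[k.1].1, fun k => l[k.1].2.1, fun k => l[k.1].2.2, fun k => (hadm k).1,
    fun k => (hadm k).2.2, fun k => (hadm k).2.1, fun x hx => ?_⟩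
  have e : ridgeComb s v (fun k : Fin l.length => l[k.1].1) (fun k => l[k.1].2.1)
      (fun k => l[k.1].2.2) x = v * ridgeAverage s l x := by
    unfold ridgeComb ridgeAverage
    rw [← Fin.sum_univ_fun_getElem]
    simp only [signedRidge]
    ring
  have e' : f x = v * ∫ q, signedRidge s (toSignedParam η q) x ∂P := hf x hx
  rw [e, e', ← mul_sub, abs_mul]
  calc _ ≤ |v| * (352001 * ridgeRate s d D l.length) := by gcongr; exact h x hx
    _ = _ := by ring

end

/-! ### Choice of the effective dimension and conclusion. -/

theorem rpow_rate_mono {m : ℕ} (hm : 1 ≤ m) {D D' : ℝ} (hD : 0 < D) (h : D ≤ D') :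
    (m : ℝ) ^ (-(1 / 2 : ℝ) - 1 / D) ≤ (m : ℝ) ^ (-(1 / 2 : ℝ) - 1 / D') := by
  refine Real.rpow_le_rpow_of_exponent_le (by exact_mod_cast hm) ?_
  have := one_div_le_one_div_of_le hD h
  linarith

theorem hasClosePairings_dim {d : ℕ} (hd : 2 ≤ d) : HasClosePairings d d := by
  rcases hd.eq_or_lt with rfl | hd
  · exact_mod_cast hasClosePairings_two
  · exact hasClosePairings_of_three_le (by omega) (by exact_mod_cast hd) le_rfl

/-- Only `d = 1` needs an effective dimension above `d`; there `D = 3` makes the greedy pairing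
applicable. -/
theorem exists_hasClosePairings {d : ℕ} (hd : 1 ≤ d) :
    ∃ D : ℝ, d ≤ D ∧ D ≤ d + 2 ∧ HasClosePairings d D := by
  rcases hd.eq_or_lt with rfl | hd
  · exact ⟨3, by norm_num, by norm_num,
      hasClosePairings_of_three_le le_rfl le_rfl (by norm_num)⟩
  · exact ⟨d, le_rfl, by linarith, hasClosePairings_dim hd⟩

theorem theorem1 :
    ∃ c : ℝ, 0 < c ∧
      ∀ (d m s : ℕ) (v : ℝ) (P : Measure (paramSpace d)) (η : paramSpace d → ℝ)
        (f : (Fin d → ℝ) → ℝ),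
        1 ≤ d → 1 ≤ m → (s = 2 ∨ s = 3) →
        IsProbabilityMeasure P → Measurable η → (∀ p, η p = -1 ∨ η p = 1) →
        HasRidgeRepresentation s v P η f →
        (2 ≤ d →
          ∃ (b t : Fin m → ℝ) (a : Fin m → Fin d → ℝ),
            (∀ k, b k ∈ Set.Icc (-1 : ℝ) 1) ∧ (∀ k, a k ∈ l1Sphere d) ∧
            (∀ k, t k ∈ Set.Icc (0 : ℝ) 1) ∧
            (s = 2 → ∀ x ∈ cube d, |f x - ridgeComb s v b t a x| ≤
              c * |v| * Real.sqrt (d + Real.log m) * (m : ℝ) ^ (-(1 / 2 : ℝ) - 1 / (d : ℝ))) ∧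
            (s = 3 → ∀ x ∈ cube d, |f x - ridgeComb s v b t a x| ≤
              c * |v| * Real.sqrt d * (m : ℝ) ^ (-(1 / 2 : ℝ) - 1 / (d : ℝ)))) ∧
        (∃ (b t : Fin m → ℝ) (a : Fin m → Fin d → ℝ),
            (∀ k, b k = -1 ∨ b k = 1) ∧ (∀ k, a k ∈ l1Sphere d) ∧
            (∀ k, t k ∈ Set.Icc (0 : ℝ) 1) ∧
            (s = 2 → ∀ x ∈ cube d, |f x - ridgeComb s v b t a x| ≤
              c * |v| * Real.sqrt (d + Real.log m) *
                (m : ℝ) ^ (-(1 / 2 : ℝ) - 1 / ((d : ℝ) + 2))) ∧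
            (s = 3 → ∀ x ∈ cube d, |f x - ridgeComb s v b t a x| ≤
              c * |v| * Real.sqrt d * (m : ℝ) ^ (-(1 / 2 : ℝ) - 1 / ((d : ℝ) + 2)))) := by
  refine ⟨352001, by norm_num, fun d m s v P η f hd hm hs hP hη hη1 hf => ?_⟩
  have hd0 : (0 : ℝ) < d := by exact_mod_cast hd
  constructor
  · intro hd2
    obtain ⟨b, t, a, hb, ha, ht, h⟩ :=
      exists_ridgeComb_ridgeRate hd hs hη hη1 le_rfl (hasClosePairings_dim hd2) hm hf
    refine ⟨b, t, a, fun k => ?_, ha, ht, ?_, ?_⟩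
    · rcases hb k with h | h <;> rw [h] <;> norm_num
    · rintro rfl x hx
      refine (h x hx).trans_eq ?_
      rw [ridgeRate, rateFactor, if_pos rfl]; ring
    · rintro rfl x hx
      refine (h x hx).trans_eq ?_
      rw [ridgeRate, rateFactor, if_neg (by norm_num)]; ring
  · obtain ⟨D, hdD, hD, hpair⟩ := exists_hasClosePairings hd
    obtain ⟨b, t, a, hb, ha, ht, h⟩ := exists_ridgeComb_ridgeRate hd hs hη hη1 hdD hpair hm hf
    have hmono := rpow_rate_mono hm (hd0.trans_le hdD) hD
    refine ⟨b, t, a, hb, ha, ht, ?_, ?_⟩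
    · rintro rfl x hx
      refine (h x hx).trans ?_
      rw [ridgeRate, rateFactor, if_pos rfl, ← mul_assoc]
      gcongr
    · rintro rfl x hx
      refine (h x hx).trans ?_
      rw [ridgeRate, rateFactor, if_neg (by norm_num), ← mul_assoc]
      gcongr
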